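/- A weight function is a continuous increasing (i.e. non-decreasing) function $\omega:[0,\infty)\to[0,\infty)$ such that: $(\alpha)$ there is $K\ge 1$ with $\omega(2x)\le K(1+\omega(x))$ for all $x\ge 0$; $(\beta)$ $\omega(x)=o(x)$ as $x\to\infty$; $(\gamma)$ there are $a\in\mathbb{R}$, $b>0$ with $\omega(x)\ge a+b\log(1+x)$ for all $x\ge 0$; $(\delta)$ $t\mapsto\omega(e^t)$ is convex on $\mathbb{R}$. For weight functions $\omega_1,\dots,\omega_d,\sigma_1,\dots,\sigma_d$ put $\Omega(x)=\sum_j\omega_j(|x_j|)$ and $\Sigma(x)=\sum_j\sigma_j(|x_j|)$, $x\in\mathbb{R}^d$. With $\hat f(\xi)=\int_{\mathbb{R}^d}e^{-ix\cdot\xi}f(x)\,dx$, let $\mathcal{S}^{\Sigma}_{\Omega}(\mathbb{R}^d)$ be the space of all $f\in L^1(\mathbb{R}^d)$ with $f,\hat f\in C^\infty(\mathbb{R}^d)$ and $$\|\exp(\lambda\Omega)D^\alpha f\|_\infty<\infty,\qquad \|\exp(\lambda\Sigma)D^\alpha\hat f\|_\infty<\infty\qquad\text{for all }\lambda>0,\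 \alpha\in\mathbb{N}_0^d,$$ with the topology given by the seminorms $\|\exp(n\Omega)D^\alpha f\|_\infty$ and $\|\exp(n\Sigma)D^\alpha\hat f\|_\infty$ ($n\in\mathbb{N}_0$, $\alpha\in\mathbb{N}_0^d$), and let $(\mathcal{S}^{\Sigma}_{\Omega})'(\mathbb{R}^d)$ be the space of continuous linear functionals on it. Every $f\in\mathcal{S}^{\Sigma}_{\Omega}(\mathbb{R}^d)$ is regarded as the element $\varphi\mapsto\int f\varphi$ of $(\mathcal{S}^{\Sigma}_{\Omega})'(\mathbb{R}^d)$. Let $\omega_{i,j},\sigma_{i,j}$ ($i=1,2$, $j=1,\dots,N$) be weight functions and define on $\mathbb{R}^{2N}=\mathbb{R}^N\times\mathbb{R}^N$ $$\Omega(x,y)=\sum_{j}\omega_{1,j}(|x_j|)+\sum_j\omega_{2,j}(|y_j|),\qquad \Sigma(x,y)=\sum_{j}\sigma_{1,j}(|x_j|)+\sum_j\sigma_{2,j}(|y_j|),$$ $$\Omega_1(x,y)=\sum_{j}\omega_{1,j}(|x_j|)+\sum_j\sigma_{2,j}(|y_j|),\qquad \Sigma_1(x,y)=\sum_{j}\sigma_{1,j}(|x_j|)+\sum_j\omega_{2,j}(|y_j|).$$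 Let $\mathcal{F}_1F(y,\xi)=\int_{\mathbb{R}^N}e^{-ix\cdot y}F(x,\xi)\,dx$ and $\mathcal{F}_2F(x,\eta)=\int_{\mathbb{R}^N}e^{-i\xi\cdot\eta}F(x,\xi)\,d\xi$. Then: (1) $\mathcal{F}_2$ is a continuous linear map $\mathcal{S}^{\Sigma}_{\Omega}(\mathbb{R}^{2N})\to\mathcal{S}^{\Sigma_1}_{\Omega_1}(\mathbb{R}^{2N})$; (2) $\mathcal{F}_1$ is a continuous linear map $\mathcal{S}^{\Sigma}_{\Omega}(\mathbb{R}^{2N})\to\mathcal{S}^{\Omega_1}_{\Sigma_1}(\mathbb{R}^{2N})$; (3) for every $\varphi\in\mathcal{S}^{\Sigma_1}_{\Omega_1}(\mathbb{R}^{2N})$ one has $\mathcal{F}_2\varphi\in\mathcal{S}^{\Sigma}_{\Omega}(\mathbb{R}^{2N})$, and $(\mathcal{F}_2u)(\varphi):=u(\mathcal{F}_2\varphi)$ defines a linear map $\mathcal{F}_2:(\mathcal{S}^{\Sigma}_{\Omega})'(\mathbb{R}^{2N})\to(\mathcal{S}^{\Sigma_1}_{\Omega_1})'(\mathbb{R}^{2N})$,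 which extends the map in (1) and is continuous both for the strong topologies and for the weak-$*$ topologies of the duals; (4) for every $\varphi\in\mathcal{S}^{\Omega_1}_{\Sigma_1}(\mathbb{R}^{2N})$ one has $\mathcal{F}_1\varphi\in\mathcal{S}^{\Sigma}_{\Omega}(\mathbb{R}^{2N})$, and $(\mathcal{F}_1u)(\varphi):=u(\mathcal{F}_1\varphi)$ defines a linear map $\mathcal{F}_1:(\mathcal{S}^{\Sigma}_{\Omega})'(\mathbb{R}^{2N})\to(\mathcal{S}^{\Omega_1}_{\Sigma_1})'(\mathbb{R}^{2N})$, which extends the map in (2) and is continuous both for the strong topologies and for the weak-$*$ topologies of the duals. -/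

import Mathlib

open scoped NNReal

noncomputable section

namespace UltraDiff

/-- A weight function on `[0, ∞)` (possibly quasianalytic, not necessarily subadditive). -/
structure WeightFunction where
  /-- the underlying function `[0, ∞) → [0, ∞)` -/
  toFun : ℝ≥0 → ℝ≥0
  continuous' : Continuous toFun
  monotone' : Monotone toFun
  alpha : ∃ K : ℝ, 1 ≤ K ∧ ∀ x : ℝ≥0, (toFun (2 * x) : ℝ) ≤ K * (1 + (toFun x : ℝ))
  beta : (fun x : ℝ≥0 => (toFun x : ℝ)) =o[Filter.atTop] (fun x : ℝ≥0 => (x : ℝ))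
  gamma : ∃ a b : ℝ, 0 < b ∧ ∀ x : ℝ≥0, a + b * Real.log (1 + (x : ℝ)) ≤ (toFun x : ℝ)
  delta : ConvexOn ℝ Set.univ (fun t : ℝ => (toFun (Real.toNNReal (Real.exp t)) : ℝ))

section Space

variable {ι : Type} [Fintype ι]

/-- The direct sum `⊕ ω_j`, that is, `x ↦ ∑ j, ω_j(|x_j|)`. -/
def directSum (ω : ι → WeightFunction) (x : EuclideanSpace ℝ ι) : ℝ :=
  ∑ j, ((ω j).toFun ‖x j‖₊ : ℝ)

/-- The Fourier transform `f ↦ ∫ exp(-i x ξ) f(x) dx`. -/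
def fourierT (f : EuclideanSpace ℝ ι → ℂ) (ξ : EuclideanSpace ℝ ι) : ℂ :=
  ∫ x : EuclideanSpace ℝ ι, Complex.exp (-(Complex.I * ((inner ℝ x ξ : ℝ) : ℂ))) * f x

open Classical in
/-- The operator `D_j = -i ∂_j`. -/
def dPartial (j : ι) (f : EuclideanSpace ℝ ι → ℂ) : EuclideanSpace ℝ ι → ℂ :=
  fun x => -Complex.I * fderiv ℝ f x (EuclideanSpace.single j 1)

/-- The composition of the powers `D_j ^ (α j)`, for `j` along the list `l`. -/
def dList (α : ι → ℕ) (l : List ι) (f : EuclideanSpace ℝ ι → ℂ) : EuclideanSpace ℝ ι → ℂ :=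
  l.foldr (fun j g => (dPartial j)^[α j] g) f

/-- The operator `D^α = ∏ j, D_j ^ (α j)` for a multi-index `α`. It is applied to smooth functions
only, for which the order of the differentiations is irrelevant. -/
def dMulti (α : ι → ℕ) (f : EuclideanSpace ℝ ι → ℂ) : EuclideanSpace ℝ ι → ℂ :=
  dList α Finset.univ.toList f

lemma dPartial_smooth (j : ι) {f : EuclideanSpace ℝ ι → ℂ} (hf : ContDiff ℝ (⊤ : ℕ∞) f) :
    ContDiff ℝ (⊤ : ℕ∞) (dPartial j f) := by
  unfold dPartial
  exact contDiff_const.mul ((hf.fderiv_right (m := ((⊤ : ℕ∞) : WithTop ℕ∞)) (by simp)).clm_apply contDiff_const)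

lemma dPartial_add (j : ι) {f g : EuclideanSpace ℝ ι → ℂ} (hf : ContDiff ℝ (⊤ : ℕ∞) f)
    (hg : ContDiff ℝ (⊤ : ℕ∞) g) : dPartial j (f + g) = dPartial j f + dPartial j g := by
  funext x
  have h1 := (hf.differentiable (by simp)) x
  have h2 := (hg.differentiable (by simp)) x
  simp only [dPartial, Pi.add_apply]
  rw [fderiv_add h1 h2, add_apply]
  ring

lemma dPartial_smul (j : ι) (c : ℂ) {f : EuclideanSpace ℝ ι → ℂ} (hf : ContDiff ℝ (⊤ : ℕ∞) f) :
    dPartial j (c • f) = c • dPartial j f := by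
  funext x
  have h1 := (hf.differentiable (by simp)) x
  simp only [dPartial, Pi.smul_apply]
  rw [fderiv_const_smul h1, smul_apply]
  simp only [smul_eq_mul]
  ring

lemma dPartial_iterate (j : ι) (n : ℕ) :
    (∀ f : EuclideanSpace ℝ ι → ℂ, ContDiff ℝ (⊤ : ℕ∞) f → ContDiff ℝ (⊤ : ℕ∞) ((dPartial j)^[n] f)) ∧
    (∀ f g : EuclideanSpace ℝ ι → ℂ, ContDiff ℝ (⊤ : ℕ∞) f → ContDiff ℝ (⊤ : ℕ∞) g →
      (dPartial j)^[n] (f + g) = (dPartial j)^[n] f + (dPartial j)^[n] g) ∧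
    (∀ (c : ℂ) (f : EuclideanSpace ℝ ι → ℂ), ContDiff ℝ (⊤ : ℕ∞) f →
      (dPartial j)^[n] (c • f) = c • (dPartial j)^[n] f) := by
  induction n with
  | zero => simp
  | succ n ih =>
    obtain ⟨h1, h2, h3⟩ := ih
    refine ⟨fun f hf => ?_, fun f g hf hg => ?_, fun c f hf => ?_⟩
    · rw [Function.iterate_succ_apply']; exact dPartial_smooth j (h1 f hf)
    · simp only [Function.iterate_succ_apply']
      rw [h2 f g hf hg, dPartial_add j (h1 f hf) (h1 g hg)]
    · simp only [Function.iterate_succ_apply']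
      rw [h3 c f hf, dPartial_smul j c (h1 f hf)]

lemma dList_props (α : ι → ℕ) (l : List ι) :
    (∀ f : EuclideanSpace ℝ ι → ℂ, ContDiff ℝ (⊤ : ℕ∞) f → ContDiff ℝ (⊤ : ℕ∞) (dList α l f)) ∧
    (∀ f g : EuclideanSpace ℝ ι → ℂ, ContDiff ℝ (⊤ : ℕ∞) f → ContDiff ℝ (⊤ : ℕ∞) g →
      dList α l (f + g) = dList α l f + dList α l g) ∧
    (∀ (c : ℂ) (f : EuclideanSpace ℝ ι → ℂ), ContDiff ℝ (⊤ : ℕ∞) f →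
      dList α l (c • f) = c • dList α l f) := by
  induction l with
  | nil => simp [dList]
  | cons j l ih =>
    obtain ⟨h1, h2, h3⟩ := ih
    obtain ⟨k1, k2, k3⟩ := dPartial_iterate (ι := ι) j (α j)
    refine ⟨fun f hf => ?_, fun f g hf hg => ?_, fun c f hf => ?_⟩
    · exact k1 _ (h1 f hf)
    · have e : ∀ h : EuclideanSpace ℝ ι → ℂ,
        dList α (j :: l) h = (dPartial j)^[α j] (dList α l h) := fun _ => rfl
      rw [e, e, e, h2 f g hf hg, k2 _ _ (h1 f hf) (h1 g hg)]
    · have e : ∀ h : EuclideanSpace ℝ ι → ℂ,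
        dList α (j :: l) h = (dPartial j)^[α j] (dList α l h) := fun _ => rfl
      rw [e, e, h3 c f hf, k3 _ _ (h1 f hf)]

lemma dMulti_add (α : ι → ℕ) {f g : EuclideanSpace ℝ ι → ℂ} (hf : ContDiff ℝ (⊤ : ℕ∞) f)
    (hg : ContDiff ℝ (⊤ : ℕ∞) g) : dMulti α (f + g) = dMulti α f + dMulti α g :=
  (dList_props α _).2.1 f g hf hg

lemma dMulti_smul (α : ι → ℕ) (c : ℂ) {f : EuclideanSpace ℝ ι → ℂ} (hf : ContDiff ℝ (⊤ : ℕ∞) f) :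
    dMulti α (c • f) = c • dMulti α f :=
  (dList_props α _).2.2 c f hf

lemma dMulti_zero_index (f : EuclideanSpace ℝ ι → ℂ) : dMulti 0 f = f := by
  unfold dMulti
  induction (Finset.univ.toList : List ι) with
  | nil => rfl
  | cons j l ih => exact ih

lemma exp_fourier_integrable {f : EuclideanSpace ℝ ι → ℂ} (hf : MeasureTheory.Integrable f)
    (ξ : EuclideanSpace ℝ ι) : MeasureTheory.Integrable
      (fun x => Complex.exp (-(Complex.I * ((inner ℝ x ξ : ℝ) : ℂ))) * f x) := by
  refine hf.bdd_mul (c := 1) (Continuous.aestronglyMeasurable (by fun_prop)) ?_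
  refine Filter.Eventually.of_forall fun x => ?_
  rw [Complex.norm_exp]
  simp

lemma fourierT_add {f g : EuclideanSpace ℝ ι → ℂ} (hf : MeasureTheory.Integrable f)
    (hg : MeasureTheory.Integrable g) : fourierT (f + g) = fourierT f + fourierT g := by
  funext ξ
  simp only [fourierT, Pi.add_apply, mul_add]
  exact MeasureTheory.integral_add (exp_fourier_integrable hf ξ) (exp_fourier_integrable hg ξ)

lemma fourierT_smul (c : ℂ) (f : EuclideanSpace ℝ ι → ℂ) :
    fourierT (c • f) = c • fourierT f := by
  funext ξ
  simp only [fourierT, Pi.smul_apply, smul_eq_mul, ← MeasureTheory.integral_const_mul]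
  congr 1
  funext x
  ring

/-- `f` is smooth and `‖exp(r Ω) D^α f‖_∞ < ∞` for all `r > 0` and all multi-indices `α`,
where `Ω` is the direct sum of the weights `ω`. -/
def WeightedDecay (ω : ι → WeightFunction) (f : EuclideanSpace ℝ ι → ℂ) : Prop :=
  ContDiff ℝ (⊤ : ℕ∞) f ∧ ∀ r : ℝ, 0 < r → ∀ α : ι → ℕ,
    ∃ C : ℝ, ∀ x, Real.exp (r * directSum ω x) * ‖dMulti α f x‖ ≤ C

/-- The quantity `‖exp(n Ω) D^α f‖_∞`. -/
def weightedSup (ω : ι → WeightFunction) (n : ℕ) (α : ι → ℕ) (f : EuclideanSpace ℝ ι → ℂ) : ℝ :=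
  ⨆ x, Real.exp (n * directSum ω x) * ‖dMulti α f x‖

lemma directSum_nonneg (ω : ι → WeightFunction) (x : EuclideanSpace ℝ ι) : 0 ≤ directSum ω x :=
  Finset.sum_nonneg fun _ _ => NNReal.coe_nonneg _

lemma WeightedDecay.add {ω : ι → WeightFunction} {f g : EuclideanSpace ℝ ι → ℂ}
    (hf : WeightedDecay ω f) (hg : WeightedDecay ω g) : WeightedDecay ω (f + g) := by
  refine ⟨hf.1.add hg.1, fun r hr α => ?_⟩
  obtain ⟨C, hC⟩ := hf.2 r hr α
  obtain ⟨C', hC'⟩ := hg.2 r hr α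
  refine ⟨C + C', fun x => ?_⟩
  rw [dMulti_add α hf.1 hg.1, Pi.add_apply]
  calc _ ≤ Real.exp (r * directSum ω x) * (‖dMulti α f x‖ + ‖dMulti α g x‖) := by
        gcongr; exact norm_add_le _ _
    _ ≤ C + C' := by rw [mul_add]; exact add_le_add (hC x) (hC' x)

lemma dMulti_zero (α : ι → ℕ) : dMulti α (0 : EuclideanSpace ℝ ι → ℂ) = 0 := by
  have h := dMulti_smul α (0 : ℂ) (f := (0 : EuclideanSpace ℝ ι → ℂ)) contDiff_const
  simpa using h

lemma WeightedDecay.zero (ω : ι → WeightFunction) :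
    WeightedDecay ω (0 : EuclideanSpace ℝ ι → ℂ) := by
  refine ⟨contDiff_const, fun r _ α => ⟨0, fun x => ?_⟩⟩
  rw [dMulti_zero]
  simp

lemma WeightedDecay.smul {ω : ι → WeightFunction} (c : ℂ) {f : EuclideanSpace ℝ ι → ℂ}
    (hf : WeightedDecay ω f) : WeightedDecay ω (c • f) := by
  refine ⟨hf.1.const_smul c, fun r hr α => ?_⟩
  obtain ⟨C, hC⟩ := hf.2 r hr α
  refine ⟨‖c‖ * C, fun x => ?_⟩
  rw [dMulti_smul α c hf.1, Pi.smul_apply, norm_smul, mul_left_comm]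
  exact mul_le_mul_of_nonneg_left (hC x) (norm_nonneg c)

lemma WeightedDecay.bddAbove {ω : ι → WeightFunction} {f : EuclideanSpace ℝ ι → ℂ}
    (hf : WeightedDecay ω f) (n : ℕ) (α : ι → ℕ) :
    BddAbove (Set.range fun x => Real.exp (n * directSum ω x) * ‖dMulti α f x‖) := by
  obtain ⟨C, hC⟩ := hf.2 (n + 1) (by positivity) α
  refine ⟨C, ?_⟩
  rintro _ ⟨x, rfl⟩
  refine le_trans ?_ (hC x)
  have := directSum_nonneg ω x
  simp only
  gcongr
  linarith

lemma weightedSup_add {ω : ι → WeightFunction} {f g : EuclideanSpace ℝ ι → ℂ}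
    (hf : WeightedDecay ω f) (hg : WeightedDecay ω g) (n : ℕ) (α : ι → ℕ) :
    weightedSup ω n α (f + g) ≤ weightedSup ω n α f + weightedSup ω n α g := by
  refine ciSup_le fun x => ?_
  rw [dMulti_add α hf.1 hg.1, Pi.add_apply]
  calc _ ≤ Real.exp (n * directSum ω x) * (‖dMulti α f x‖ + ‖dMulti α g x‖) := by
        gcongr; exact norm_add_le _ _
    _ ≤ _ := by
        rw [mul_add]
        exact add_le_add (le_ciSup (hf.bddAbove n α) x) (le_ciSup (hg.bddAbove n α) x)

lemma weightedSup_smul {ω : ι → WeightFunction} (c : ℂ) {f : EuclideanSpace ℝ ι → ℂ}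
    (hf : WeightedDecay ω f) (n : ℕ) (α : ι → ℕ) :
    weightedSup ω n α (c • f) = ‖c‖ * weightedSup ω n α f := by
  unfold weightedSup
  rw [Real.mul_iSup_of_nonneg (norm_nonneg c)]
  congr 1
  funext x
  rw [dMulti_smul α c hf.1, Pi.smul_apply, norm_smul, mul_left_comm]

/-- The functions `f ∈ L¹` such that `f` and `f̂` are smooth, all derivatives of `f` decay with
respect to the direct sum of `ω`, and all derivatives of `f̂` with respect to that of `σ`. -/
def swoSubmodule (ω σ : ι → WeightFunction) : Submodule ℂ (EuclideanSpace ℝ ι → ℂ) where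
  carrier := {f | MeasureTheory.Integrable f ∧ WeightedDecay ω f ∧ WeightedDecay σ (fourierT f)}
  add_mem' := by
    rintro f g ⟨h1, h2, h3⟩ ⟨k1, k2, k3⟩
    refine ⟨h1.add k1, h2.add k2, ?_⟩
    rw [fourierT_add h1 k1]
    exact h3.add k3
  zero_mem' := by
    refine ⟨MeasureTheory.integrable_zero _ _ _, WeightedDecay.zero ω, ?_⟩
    have h : fourierT (0 : EuclideanSpace ℝ ι → ℂ) = 0 := by
      simpa using fourierT_smul (0 : ℂ) (0 : EuclideanSpace ℝ ι → ℂ)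
    rw [h]
    exact WeightedDecay.zero σ
  smul_mem' := by
    rintro c f ⟨h1, h2, h3⟩
    refine ⟨h1.smul c, h2.smul c, ?_⟩
    rw [fourierT_smul]
    exact h3.smul c

/-- The space `𝒮_Ω^Σ` with `Ω = ⊕ ω_j` (decay of `f`) and `Σ = ⊕ σ_j` (decay of `f̂`). It is a
type copy of the submodule above, which carries the Fréchet topology instead of the topology of
pointwise convergence. -/
def Swo (ω σ : ι → WeightFunction) : Type := ↥(swoSubmodule ω σ)

variable (ω σ : ι → WeightFunction)

instance : AddCommGroup (Swo ω σ) := inferInstanceAs (AddCommGroup ↥(swoSubmodule ω σ))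

instance : Module ℂ (Swo ω σ) := inferInstanceAs (Module ℂ ↥(swoSubmodule ω σ))

instance : CoeFun (Swo ω σ) (fun _ => EuclideanSpace ℝ ι → ℂ) := ⟨fun f => f.1⟩

/-- The seminorms `‖exp(n Ω) D^α f‖_∞` and `‖exp(n Σ) D^α f̂‖_∞`. -/
def swoSeminorm : SeminormFamily ℂ (Swo ω σ) ((ℕ × (ι → ℕ)) ⊕ (ℕ × (ι → ℕ)))
  | Sum.inl p => Seminorm.of (fun f => weightedSup ω p.1 p.2 f.1)
      (fun f g => weightedSup_add f.2.2.1 g.2.2.1 p.1 p.2)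
      (fun c f => weightedSup_smul c f.2.2.1 p.1 p.2)
  | Sum.inr p => Seminorm.of (fun f => weightedSup σ p.1 p.2 (fourierT f.1))
      (fun f g => by
        have h : (f + g).1 = f.1 + g.1 := rfl
        rw [h, fourierT_add f.2.1 g.2.1]
        exact weightedSup_add f.2.2.2 g.2.2.2 p.1 p.2)
      (fun c f => by
        have h : (c • f).1 = c • f.1 := rfl
        rw [h, fourierT_smul]
        exact weightedSup_smul c f.2.2.2 p.1 p.2)

instance : TopologicalSpace (Swo ω σ) := (swoSeminorm ω σ).moduleFilterBasis.topology

lemma swo_withSeminorms : WithSeminorms (swoSeminorm ω σ) := ⟨rfl⟩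

instance : IsTopologicalAddGroup (Swo ω σ) :=
  (swoSeminorm ω σ).addGroupFilterBasis.isTopologicalAddGroup

instance : ContinuousSMul ℂ (Swo ω σ) := (swoSeminorm ω σ).moduleFilterBasis.continuousSMul

variable {ω σ}

lemma swo_norm_le (φ : Swo ω σ) (x : EuclideanSpace ℝ ι) :
    ‖φ x‖ ≤ swoSeminorm ω σ (Sum.inl (0, 0)) φ := by
  have h := le_ciSup (φ.2.2.1.bddAbove 0 0) x
  simp only [Nat.cast_zero, zero_mul, Real.exp_zero, one_mul, dMulti_zero_index] at h
  refine h.trans (le_of_eq ?_)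
  show _ = weightedSup ω 0 0 φ.1
  simp [weightedSup, dMulti_zero_index]

lemma swo_mul_integrable (f φ : Swo ω σ) : MeasureTheory.Integrable (fun x => f x * φ x) := by
  refine f.2.1.mul_bdd (c := swoSeminorm ω σ (Sum.inl (0, 0)) φ) ?_ ?_
  · exact φ.2.2.1.1.continuous.aestronglyMeasurable
  · exact Filter.Eventually.of_forall (swo_norm_le φ)

/-- The ultradistribution `φ ↦ ∫ f φ` given by a function `f`. -/
def regularDist (f : Swo ω σ) : StrongDual ℂ (Swo ω σ) where
  toFun φ := ∫ x, f x * φ x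
  map_add' φ ψ := by
    rw [← MeasureTheory.integral_add (swo_mul_integrable f φ) (swo_mul_integrable f ψ)]
    congr 1
    funext x
    exact mul_add _ _ _
  map_smul' c φ := by
    rw [RingHom.id_apply, smul_eq_mul, ← MeasureTheory.integral_const_mul]
    congr 1
    funext x
    exact mul_left_comm _ _ _
  cont := by
    let L : Swo ω σ →ₗ[ℂ] ℂ :=
      { toFun := fun φ => ∫ x, f x * φ x
        map_add' := fun φ ψ => by
          rw [← MeasureTheory.integral_add (swo_mul_integrable f φ) (swo_mul_integrable f ψ)]
          congr 1
          funext x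
          exact mul_add _ _ _
        map_smul' := fun c φ => by
          rw [RingHom.id_apply, smul_eq_mul, ← MeasureTheory.integral_const_mul]
          congr 1
          funext x
          exact mul_left_comm _ _ _ }
    show Continuous L
    refine WithSeminorms.continuous_normedSpace_rng ℂ (swo_withSeminorms ω σ) L ?_
    refine ⟨{Sum.inl (0, 0)}, ⟨∫ x, ‖f x‖, MeasureTheory.integral_nonneg fun _ => norm_nonneg _⟩,
      fun φ => ?_⟩
    simp only [Finset.sup_singleton]
    show ‖∫ x, f x * φ x‖ ≤ (∫ x, ‖f x‖) * swoSeminorm ω σ (Sum.inl (0, 0)) φ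
    rw [← MeasureTheory.integral_mul_const]
    refine MeasureTheory.norm_integral_le_of_norm_le (f.2.1.norm.mul_const _) ?_
    refine Filter.Eventually.of_forall fun x => ?_
    rw [norm_mul]
    exact mul_le_mul_of_nonneg_left (swo_norm_le φ x) (norm_nonneg _)

end Space

section PartialFourier

variable {N : ℕ}

/-- `ℝ^{2N}`, whose coordinates are indexed by two blocks of `N` indices. -/
abbrev R2 (N : ℕ) : Type := EuclideanSpace ℝ (Fin N ⊕ Fin N)

/-- The point `(x, y)` of `ℝ^{2N}`. -/
def pair (x y : EuclideanSpace ℝ (Fin N)) : R2 N :=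
  WithLp.toLp 2 (Sum.elim (fun j => x j) (fun j => y j))

/-- The first block of variables. -/
def fstBlock (z : R2 N) : EuclideanSpace ℝ (Fin N) := WithLp.toLp 2 (fun j => z (Sum.inl j))

/-- The second block of variables. -/
def sndBlock (z : R2 N) : EuclideanSpace ℝ (Fin N) := WithLp.toLp 2 (fun j => z (Sum.inr j))

/-- The partial Fourier transform in the first block,
`(y, ξ) ↦ ∫ exp(-i x y) F(x, ξ) dx`. -/
def partialFourier₁ (F : R2 N → ℂ) (z : R2 N) : ℂ :=
  ∫ x : EuclideanSpace ℝ (Fin N),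
    Complex.exp (-(Complex.I * ((inner ℝ x (fstBlock z) : ℝ) : ℂ))) * F (pair x (sndBlock z))

/-- The partial Fourier transform in the second block,
`(x, η) ↦ ∫ exp(-i ξ η) F(x, ξ) dξ`. -/
def partialFourier₂ (F : R2 N → ℂ) (z : R2 N) : ℂ :=
  ∫ ξ : EuclideanSpace ℝ (Fin N),
    Complex.exp (-(Complex.I * ((inner ℝ ξ (sndBlock z) : ℝ) : ℂ))) * F (pair (fstBlock z) ξ)

/-- The weights of `ω` in the first block and those of `σ` in the second block. -/
def mixWeights (ω σ : Fin N ⊕ Fin N → WeightFunction) : Fin N ⊕ Fin N → WeightFunction :=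
  Sum.elim (fun j => ω (Sum.inl j)) (fun j => σ (Sum.inr j))

end PartialFourier

end UltraDiff

end

open UltraDiff

/-!
Differentiation under the integral sign turns `D_j` of `ℱ₂ f` into `ℱ₂` of `D_j f` (first block) or
of `-y_j f` (second block). As `D_j` and multiplication by coordinates act continuously on
`𝒮_Ω^Σ`, the weighted estimates for all derivatives of `ℱ₂ f` reduce to those for `ℱ₂ f` itself.
Decay in the first block comes from integrating the decay of `f` over the second block. Decay in
the second block comes from Fourier inversion in the first one, `(2π)^N ℱ₂f(-x, η) = ℱ₁(f̂)(x, η)`,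
where the decay of `f̂` is integrated over the first block; the two are combined by
`exp (a + b) ≤ exp (2a) + exp (2b)`. The Fourier transform of `ℱ₂ f` is `ℱ₂ (f̂)`, so the same
estimates apply to it with `ω` and `σ` exchanged.

Exchanging the two blocks of variables reduces `ℱ₁` to `ℱ₂`. Mixing the weights twice gives back
the original ones, so the same maps also go in the opposite direction, and the maps on the duals
are their transposes, which extend `ℱ₁` and `ℱ₂` by Fubini's theorem and
`∫ f ĝ = ∫ f̂ g`.
-/

namespace UltraDiff

open Complex Filter MeasureTheory
open scoped FourierTransform

noncomputable section

section MultiIndexDerivatives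

variable {ι : Type}

lemma dPartial_apply [DecidableEq ι] (j : ι) (f : EuclideanSpace ℝ ι → ℂ)
    (x : EuclideanSpace ℝ ι) :
    dPartial j f x = -I * fderiv ℝ f x (EuclideanSpace.single j 1) := by
  rw [dPartial]
  congr!

lemma dList_cons (α : ι → ℕ) (j : ι) (l : List ι) (f : EuclideanSpace ℝ ι → ℂ) :
    dList α (j :: l) f = (dPartial j)^[α j] (dList α l f) :=
  rfl

lemma dList_congr {α β : ι → ℕ} {l : List ι} (h : ∀ j ∈ l, α j = β j)
    (f : EuclideanSpace ℝ ι → ℂ) : dList α l f = dList β l f := by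
  induction l with
  | nil => rfl
  | cons j l ih =>
    rw [dList_cons, dList_cons, h j List.mem_cons_self,
      ih fun i hi => h i (List.mem_cons_of_mem j hi)]

/-- The functional `z ↦ i z_j`; the factor `i` makes `∑ j, D_j f • coordI j` the differential
of `f`. -/
def coordI (j : ι) : EuclideanSpace ℝ ι →L[ℝ] ℂ :=
  I • (ofRealCLM ∘L EuclideanSpace.proj j)

@[simp]
lemma coordI_apply (j : ι) (z : EuclideanSpace ℝ ι) : coordI j z = I * (z j : ℂ) :=
  rfl

lemma dPartial_coord_mul [Finite ι] [DecidableEq ι] {f : EuclideanSpace ℝ ι → ℂ}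
    (hf : Differentiable ℝ f) (i j : ι) (x : EuclideanSpace ℝ ι) :
    dPartial i (fun x => x j * f x) x =
      x j * dPartial i f x + (if i = j then -I else 0) * f x := by
  cases nonempty_fintype ι
  have hcoord : HasFDerivAt (fun x : EuclideanSpace ℝ ι => (x j : ℂ))
      (ofRealCLM ∘L EuclideanSpace.proj j) x :=
    (ofRealCLM ∘L EuclideanSpace.proj (𝕜 := ℝ) j).hasFDerivAt
  rw [dPartial_apply, (hcoord.fun_mul (hf x).hasFDerivAt).fderiv, dPartial_apply]
  simp only [add_apply, smul_apply, smul_eq_mul, ContinuousLinearMap.comp_apply, PiLp.proj_apply,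
    PiLp.single_apply, ofRealCLM_apply, eq_comm (a := j)]
  split_ifs
  · rw [ofReal_one]
    ring
  · rw [ofReal_zero]
    ring

variable [Fintype ι] {f : EuclideanSpace ℝ ι → ℂ}

lemma dPartial_dPartial_apply [DecidableEq ι] (hf : ContDiff ℝ (⊤ : ℕ∞) f) (i j : ι)
    (x : EuclideanSpace ℝ ι) :
    dPartial i (dPartial j f) x =
      -fderiv ℝ (fderiv ℝ f) x (EuclideanSpace.single i 1) (EuclideanSpace.single j 1) := by
  have hf' : DifferentiableAt ℝ (fderiv ℝ f) x :=
    (hf.fderiv_right (m := (⊤ : ℕ∞)) (by simp)).differentiable (by simp) x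
  have hj : dPartial j f = fun y => -I * fderiv ℝ f y (EuclideanSpace.single j 1) :=
    funext (dPartial_apply j f)
  rw [dPartial_apply, hj, fderiv_const_mul (hf'.clm_apply (differentiableAt_const _)),
    fderiv_clm_apply hf' (differentiableAt_const _)]
  simp only [fderiv_fun_const, Pi.zero_apply, ContinuousLinearMap.comp_zero, zero_add,
    smul_apply, ContinuousLinearMap.flip_apply, smul_eq_mul]
  linear_combination fderiv ℝ (fderiv ℝ f) x (EuclideanSpace.single i 1)
    (EuclideanSpace.single j 1) * I_mul_I

lemma dPartial_comm (hf : ContDiff ℝ (⊤ : ℕ∞) f) (i j : ι) :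
    dPartial i (dPartial j f) = dPartial j (dPartial i f) := by
  classical
  funext x
  have hsymm : IsSymmSndFDerivAt ℝ f x :=
    hf.contDiffAt.isSymmSndFDerivAt
      (by simpa using WithTop.coe_le_coe.2 (le_top (a := (2 : ℕ∞))))
  rw [dPartial_dPartial_apply hf, dPartial_dPartial_apply hf, hsymm.eq]

lemma dPartial_iterate_dPartial (hf : ContDiff ℝ (⊤ : ℕ∞) f) (i j : ι) (n : ℕ) :
    (dPartial i)^[n] (dPartial j f) = dPartial j ((dPartial i)^[n] f) := by
  induction n with
  | zero => rfl
  | succ n ih =>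
    rw [Function.iterate_succ_apply', ih, Function.iterate_succ_apply',
      dPartial_comm ((dPartial_iterate i n).1 f hf)]

lemma dList_dPartial (hf : ContDiff ℝ (⊤ : ℕ∞) f) (α : ι → ℕ) (l : List ι) (j : ι) :
    dList α l (dPartial j f) = dPartial j (dList α l f) := by
  induction l with
  | nil => rfl
  | cons i l ih =>
    rw [dList_cons, ih, dPartial_iterate_dPartial ((dList_props α l).1 f hf), dList_cons]

lemma dList_add_single [DecidableEq ι] (hf : ContDiff ℝ (⊤ : ℕ∞) f) (α : ι → ℕ) {l : List ι}
    (hl : l.Nodup) {j : ι} (hj : j ∈ l) :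
    dList (α + Pi.single j 1) l f = dPartial j (dList α l f) := by
  induction l with
  | nil => simp at hj
  | cons i l ih =>
    obtain ⟨hi, hl⟩ := List.nodup_cons.1 hl
    rw [dList_cons, dList_cons]
    obtain rfl | hji := eq_or_ne j i
    · have htail : dList (α + Pi.single j 1) l f = dList α l f :=
        dList_congr (fun k hk => by simp [ne_of_mem_of_not_mem hk hi]) f
      rw [htail, Pi.add_apply, Pi.single_eq_same, Function.iterate_succ_apply']
    · rw [ih hl (List.mem_of_ne_of_mem hji hj), Pi.add_apply, Pi.single_eq_of_ne hji.symm,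
        add_zero, dPartial_iterate_dPartial ((dList_props α l).1 f hf)]

lemma dMulti_dPartial [DecidableEq ι] (hf : ContDiff ℝ (⊤ : ℕ∞) f) (α : ι → ℕ) (j : ι) :
    dMulti α (dPartial j f) = dMulti (α + Pi.single j 1) f := by
  rw [dMulti, dMulti, dList_dPartial hf,
    dList_add_single hf α (Finset.nodup_toList _) (Finset.mem_toList.2 (Finset.mem_univ j))]

lemma dMulti_mem_of_dPartial_mem {V : Type*} {𝒞 : Set (V → EuclideanSpace ℝ ι → ℂ)}
    (h𝒞 : ∀ T ∈ 𝒞, ∀ j, (fun v => dPartial j (T v)) ∈ 𝒞) {T : V → EuclideanSpace ℝ ι → ℂ}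
    (hT : T ∈ 𝒞) (α : ι → ℕ) : (fun v => dMulti α (T v)) ∈ 𝒞 := by
  have iterate_mem : ∀ j n, ∀ S ∈ 𝒞, (fun v => (dPartial j)^[n] (S v)) ∈ 𝒞 := by
    intro j n
    induction n with
    | zero => exact fun S hS => hS
    | succ _ ih => exact fun S hS => ih _ (h𝒞 S hS j)
  have dList_mem : ∀ l, (fun v => dList α l (T v)) ∈ 𝒞 := by
    intro l
    induction l with
    | nil => exact hT
    | cons j l ih => exact iterate_mem j (α j) _ ih
  exact dList_mem _

lemma hasFDerivAt_sum_dPartial {x : EuclideanSpace ℝ ι} (hf : DifferentiableAt ℝ f x) :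
    HasFDerivAt f (∑ j, dPartial j f x • coordI j) x := by
  classical
  convert! hf.hasFDerivAt using 1
  ext v
  conv_rhs => rw [← (EuclideanSpace.basisFun ι ℝ).sum_repr v]
  simp only [map_sum, sum_apply, map_smul, smul_apply, coordI_apply,
    dPartial_apply, EuclideanSpace.basisFun_repr, EuclideanSpace.basisFun_apply, smul_eq_mul,
    real_smul]
  refine Finset.sum_congr rfl fun j _ => ?_
  linear_combination -(fderiv ℝ f x (EuclideanSpace.single j 1)) * v j * I_mul_I

lemma dPartial_eq_of_hasFDerivAt {x : EuclideanSpace ℝ ι} {g : ι → ℂ}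
    (hf : HasFDerivAt f (∑ j, g j • coordI j) x) (i : ι) : dPartial i f x = g i := by
  classical
  rw [dPartial_apply, hf.fderiv]
  simp only [sum_apply, smul_apply, coordI_apply, PiLp.single_apply,
    smul_eq_mul]
  rw [Finset.sum_eq_single i (fun j _ hj => by simp [hj]) (by simp), if_pos rfl, ofReal_one]
  linear_combination -(g i) * I_mul_I

lemma contDiff_of_hasFDerivAt_coordI {V : Type*} {T : V → EuclideanSpace ℝ ι → ℂ} {S : ι → V → V}
    (hT : ∀ v x, HasFDerivAt (T v) (∑ j, T (S j v) x • coordI j) x) (v : V) :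
    ContDiff ℝ (⊤ : ℕ∞) (T v) := by
  suffices ∀ (n : ℕ) (v : V), ContDiff ℝ n (T v) from contDiff_infty.2 fun n => this n v
  intro n
  induction n with
  | zero =>
    intro v
    exact contDiff_zero.2 (continuous_iff_continuousAt.2 fun x => (hT v x).continuousAt)
  | succ n ih =>
    intro v
    exact contDiff_succ_iff_hasFDerivAt.2
      ⟨_, ContDiff.sum fun j _ => (ih (S j v)).smul contDiff_const, hT v⟩

lemma dPartial_comp_clm {κ : Type} [Finite κ] [DecidableEq κ] (hf : Differentiable ℝ f)
    (L : EuclideanSpace ℝ κ →L[ℝ] EuclideanSpace ℝ ι) (j : κ) (x : EuclideanSpace ℝ κ) :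
    dPartial j (f ∘ L) x =
      ∑ i, (L (EuclideanSpace.single j 1) i : ℂ) * dPartial i f (L x) := by
  cases nonempty_fintype κ
  rw [dPartial_apply, ((hasFDerivAt_sum_dPartial (hf (L x))).comp x L.hasFDerivAt).fderiv]
  simp only [ContinuousLinearMap.comp_apply, sum_apply, smul_apply, coordI_apply, smul_eq_mul,
    Finset.mul_sum]
  refine Finset.sum_congr rfl fun i _ => ?_
  linear_combination -(dPartial i f (L x) * L (EuclideanSpace.single j 1) i) * I_mul_I

lemma contDiff_coord (j : ι) : ContDiff ℝ (⊤ : ℕ∞) fun x : EuclideanSpace ℝ ι => (x j : ℂ) :=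
  (ofRealCLM ∘L EuclideanSpace.proj (𝕜 := ℝ) j).contDiff

end MultiIndexDerivatives

section Weights

variable {ι : Type} [Fintype ι]

lemma WeightFunction.exists_one_add_le_mul_exp (w : WeightFunction) :
    ∃ (k : ℕ) (C : ℝ), ∀ t : ℝ≥0, 1 + (t : ℝ) ≤ C * Real.exp (k * w.toFun t) := by
  obtain ⟨a, b, hb, hw⟩ := w.gamma
  obtain ⟨k, hk⟩ := exists_nat_ge b⁻¹
  refine ⟨k, Real.exp (-(b⁻¹ * a)), fun t => ?_⟩
  have hlog : Real.log (1 + t) ≤ b⁻¹ * (w.toFun t - a) := by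
    rw [le_inv_mul_iff₀ hb]
    linarith [hw t]
  calc 1 + (t : ℝ) = Real.exp (Real.log (1 + t)) := (Real.exp_log (by positivity)).symm
    _ ≤ Real.exp (-(b⁻¹ * a) + k * w.toFun t) := by
        rw [Real.exp_le_exp]
        linarith [mul_le_mul_of_nonneg_right hk (w.toFun t).coe_nonneg]
    _ = _ := Real.exp_add _ _

lemma continuous_directSum (ω : ι → WeightFunction) : Continuous (directSum ω) := by
  have hω : ∀ j, Continuous (ω j).toFun := fun j => (ω j).continuous'
  unfold directSum
  fun_prop

lemma le_directSum (ω : ι → WeightFunction) (x : EuclideanSpace ℝ ι) (j : ι) :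
    ((ω j).toFun ‖x j‖₊ : ℝ) ≤ directSum ω x :=
  Finset.single_le_sum (f := fun j => ((ω j).toFun ‖x j‖₊ : ℝ)) (fun _ _ => NNReal.coe_nonneg _)
    (Finset.mem_univ j)

lemma norm_le_sum_norm_apply (x : EuclideanSpace ℝ ι) : ‖x‖ ≤ ∑ j, ‖x j‖ := by
  classical
  calc ‖x‖ = ‖∑ j, x j • EuclideanSpace.basisFun ι ℝ j‖ := by
        conv_lhs => rw [← (EuclideanSpace.basisFun ι ℝ).sum_repr x]
        rfl
    _ ≤ ∑ j, ‖x j • EuclideanSpace.basisFun ι ℝ j‖ := norm_sum_le _ _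
    _ = ∑ j, ‖x j‖ := by simp [norm_smul]

lemma exists_one_add_norm_pow_le (ω : ι → WeightFunction) (m : ℕ) :
    ∃ (k : ℕ) (C : ℝ), ∀ x, (1 + ‖x‖) ^ m ≤ C * Real.exp (k * directSum ω x) := by
  choose k C hC using fun j => (ω j).exists_one_add_le_mul_exp
  set K := ∑ j, k j
  have coord_le : ∀ x j, ‖x j‖ ≤ |C j| * Real.exp (K * directSum ω x) := by
    intro x j
    have hk : k j ≤ K := Finset.single_le_sum (fun _ _ => Nat.zero_le _) (Finset.mem_univ j)
    calc ‖x j‖ ≤ 1 + ‖x j‖ := by linarith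
      _ ≤ C j * Real.exp (k j * (ω j).toFun ‖x j‖₊) := hC j ‖x j‖₊
      _ ≤ |C j| * Real.exp (K * directSum ω x) := by
          gcongr
          · exact le_abs_self _
          · exact le_directSum ω x j
  refine ⟨m * K, (1 + ∑ j, |C j|) ^ m, fun x => ?_⟩
  have one_le : 1 ≤ Real.exp (K * directSum ω x) :=
    Real.one_le_exp (mul_nonneg K.cast_nonneg (directSum_nonneg ω x))
  calc (1 + ‖x‖) ^ m
      ≤ (1 + ∑ j, |C j| * Real.exp (K * directSum ω x)) ^ m := by
        gcongr
        exact (norm_le_sum_norm_apply x).trans (Finset.sum_le_sum fun j _ => coord_le x j)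
    _ ≤ ((1 + ∑ j, |C j|) * Real.exp (K * directSum ω x)) ^ m := by
        rw [← Finset.sum_mul, add_mul, one_mul]
        gcongr
    _ = (1 + ∑ j, |C j|) ^ m * Real.exp (↑(m * K) * directSum ω x) := by
        rw [mul_pow, ← Real.exp_nat_mul, Nat.cast_mul, mul_assoc]

lemma exists_integrable_exp_neg (ω : ι → WeightFunction) :
    ∃ k : ℕ, Integrable fun x : EuclideanSpace ℝ ι => Real.exp (-(k * directSum ω x)) := by
  set m := Module.finrank ℝ (EuclideanSpace ℝ ι) + 1 with hm
  obtain ⟨k, C, hC⟩ := exists_one_add_norm_pow_le ω m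
  have hint : Integrable fun x : EuclideanSpace ℝ ι => C * (1 + ‖x‖) ^ (-(m : ℝ)) :=
    (integrable_one_add_norm (by simp [hm])).const_mul C
  have hcont := continuous_directSum ω
  refine ⟨k, hint.mono' (Continuous.aestronglyMeasurable (by fun_prop)) (ae_of_all _ fun x => ?_)⟩
  rw [Real.norm_of_nonneg (Real.exp_nonneg _), Real.exp_neg, Real.rpow_neg (by positivity),
    Real.rpow_natCast, ← div_eq_mul_inv, le_div_iff₀ (by positivity),
    inv_mul_le_iff₀ (Real.exp_pos _), mul_comm]
  exact hC x

lemma le_mul_exp_neg {s a C : ℝ} (h : Real.exp s * a ≤ C) : a ≤ C * Real.exp (-s) := by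
  rwa [Real.exp_neg, ← div_eq_mul_inv, le_div_iff₀ (Real.exp_pos _), mul_comm]

lemma WeightedDecay.integrable {ω : ι → WeightFunction} {f : EuclideanSpace ℝ ι → ℂ}
    (hf : WeightedDecay ω f) : Integrable f := by
  obtain ⟨k, hk⟩ := exists_integrable_exp_neg ω
  obtain ⟨C, hC⟩ := hf.bddAbove k 0
  refine (hk.const_mul C).mono' hf.1.continuous.aestronglyMeasurable (ae_of_all _ fun x => ?_)
  have hx := hC (Set.mem_range_self x)
  rw [dMulti_zero_index] at hx
  exact le_mul_exp_neg hx

end Weights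

section ControlledDecay

variable {V W : Type*} [AddCommGroup V] [Module ℂ V] [TopologicalSpace V] [AddCommGroup W]
  [Module ℂ W] [TopologicalSpace W]

/-- A family of real functions on `X`, parametrised by a topological vector space `V`, is dominated
if it is bounded, uniformly on `X`, by a continuous seminorm of the parameter. -/
def SeminormDominated {X : Type*} (F : V → X → ℝ) : Prop :=
  ∃ q : Seminorm ℂ V, Continuous q ∧ ∀ v x, F v x ≤ q v

namespace SeminormDominated

variable {X : Type*} {F G : V → X → ℝ}

lemma mono (hG : SeminormDominated G) (h : ∀ v x, F v x ≤ G v x) : SeminormDominated F :=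
  let ⟨q, hq, hqG⟩ := hG
  ⟨q, hq, fun v x => (h v x).trans (hqG v x)⟩

lemma add (hF : SeminormDominated F) (hG : SeminormDominated G) :
    SeminormDominated fun v x => F v x + G v x :=
  let ⟨p, hp, hpF⟩ := hF
  let ⟨q, hq, hqG⟩ := hG
  ⟨p + q, hp.add hq, fun v x => add_le_add (hpF v x) (hqG v x)⟩

lemma const_mul (hF : SeminormDominated F) (c : ℝ≥0) : SeminormDominated fun v x => c * F v x :=
  let ⟨q, hq, hqF⟩ := hF
  ⟨c • q, continuous_const.mul hq, fun v x => mul_le_mul_of_nonneg_left (hqF v x) c.coe_nonneg⟩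

lemma comp (hF : SeminormDominated F) (A : W →L[ℂ] V) : SeminormDominated fun w => F (A w) :=
  let ⟨q, hq, hqF⟩ := hF
  ⟨q.comp A.toLinearMap, hq.comp A.continuous, fun w => hqF (A w)⟩

lemma comp_right {Y : Type*} (hF : SeminormDominated F) (g : Y → X) :
    SeminormDominated fun v y => F v (g y) :=
  let ⟨q, hq, hqF⟩ := hF
  ⟨q, hq, fun v y => hqF v (g y)⟩

end SeminormDominated

variable {ι κ : Type} [Fintype ι] [Fintype κ]

/-- A family `T` of functions, parametrised by a topological vector space, has controlled decay if
every `T v` is smooth and every seminorm `‖exp(n Ω) D^α (T v)‖_∞`, where `Ω` is the direct sum of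
the weights `ω`, is bounded by a continuous seminorm of `v`. A linear family of this kind is a
continuous map into the space of functions satisfying `WeightedDecay ω`. -/
structure ControlledDecay (ω : ι → WeightFunction) (T : V → EuclideanSpace ℝ ι → ℂ) : Prop where
  contDiff : ∀ v, ContDiff ℝ (⊤ : ℕ∞) (T v)
  dominated : ∀ (n : ℕ) (α : ι → ℕ),
    SeminormDominated fun v x => Real.exp (n * directSum ω x) * ‖dMulti α (T v) x‖

variable {ω : ι → WeightFunction} {T T' : V → EuclideanSpace ℝ ι → ℂ}

namespace ControlledDecay

lemma dominated_zero (hT : ControlledDecay ω T) (n : ℕ) :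
    SeminormDominated fun v x => Real.exp (n * directSum ω x) * ‖T v x‖ := by
  simpa only [dMulti_zero_index] using hT.dominated n 0

lemma of_dPartial_mem {𝒞 : Set (V → EuclideanSpace ℝ ι → ℂ)}
    (hsmooth : ∀ S ∈ 𝒞, ∀ v, ContDiff ℝ (⊤ : ℕ∞) (S v))
    (hdom : ∀ S ∈ 𝒞, ∀ n : ℕ, SeminormDominated fun v x => Real.exp (n * directSum ω x) * ‖S v x‖)
    (hclosed : ∀ S ∈ 𝒞, ∀ j, (fun v => UltraDiff.dPartial j (S v)) ∈ 𝒞) (hT : T ∈ 𝒞) :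
    ControlledDecay ω T where
  contDiff := hsmooth T hT
  dominated n α := hdom _ (dMulti_mem_of_dPartial_mem hclosed hT α) n

lemma weightedDecay (hT : ControlledDecay ω T) (v : V) : WeightedDecay ω (T v) := by
  refine ⟨hT.contDiff v, fun r _ α => ?_⟩
  obtain ⟨n, hn⟩ := exists_nat_ge r
  obtain ⟨q, -, hq⟩ := hT.dominated n α
  refine ⟨q v, fun x => ?_⟩
  have := directSum_nonneg ω x
  calc Real.exp (r * directSum ω x) * ‖dMulti α (T v) x‖
      ≤ Real.exp (n * directSum ω x) * ‖dMulti α (T v) x‖ := by gcongr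
    _ ≤ q v := hq v x

lemma integrable (hT : ControlledDecay ω T) (v : V) : Integrable (T v) :=
  (hT.weightedDecay v).integrable

lemma comp (hT : ControlledDecay ω T) (A : W →L[ℂ] V) : ControlledDecay ω fun w => T (A w) where
  contDiff w := hT.contDiff (A w)
  dominated n α := (hT.dominated n α).comp A

lemma zero : ControlledDecay ω (0 : V → EuclideanSpace ℝ ι → ℂ) where
  contDiff _ := contDiff_const
  dominated n α := ⟨0, continuous_const, fun v x => by simp [dMulti_zero]⟩

lemma add (hT : ControlledDecay ω T) (hT' : ControlledDecay ω T') : ControlledDecay ω (T + T') where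
  contDiff v := (hT.contDiff v).add (hT'.contDiff v)
  dominated n α := ((hT.dominated n α).add (hT'.dominated n α)).mono fun v x => by
    rw [Pi.add_apply, dMulti_add α (hT.contDiff v) (hT'.contDiff v), Pi.add_apply, ← mul_add]
    exact mul_le_mul_of_nonneg_left (norm_add_le _ _) (Real.exp_nonneg _)

lemma const_smul (hT : ControlledDecay ω T) (c : ℂ) : ControlledDecay ω (c • T) where
  contDiff v := (hT.contDiff v).const_smul c
  dominated n α := ((hT.dominated n α).const_mul ‖c‖₊).mono fun v x => by
    rw [Pi.smul_apply, dMulti_smul α c (hT.contDiff v), Pi.smul_apply, norm_smul, mul_left_comm,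
      coe_nnnorm]

lemma sum {β : Type*} {s : Finset β} {S : β → V → EuclideanSpace ℝ ι → ℂ}
    (hS : ∀ i ∈ s, ControlledDecay ω (S i)) : ControlledDecay ω (∑ i ∈ s, S i) :=
  Finset.sum_induction S (ControlledDecay ω) (fun _ _ => add) zero hS

lemma dPartial (hT : ControlledDecay ω T) (j : ι) :
    ControlledDecay ω fun v => dPartial j (T v) where
  contDiff v := dPartial_smooth j (hT.contDiff v)
  dominated n α := by
    classical
    simpa only [dMulti_dPartial (hT.contDiff _)] using hT.dominated n (α + Pi.single j 1)

lemma comp_clm (hT : ControlledDecay ω T) (L : EuclideanSpace ℝ κ →L[ℝ] EuclideanSpace ℝ ι)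
    {ω' : κ → WeightFunction} (hω : ∀ x, directSum ω' x ≤ directSum ω (L x)) :
    ControlledDecay ω' fun v => T v ∘ L := by
  classical
  refine of_dPartial_mem (𝒞 := {S | ∃ R, ControlledDecay ω R ∧ S = fun v => R v ∘ L}) ?_ ?_ ?_
    ⟨T, hT, rfl⟩
  · rintro _ ⟨R, hR, rfl⟩ v
    exact (hR.contDiff v).comp L.contDiff
  · rintro _ ⟨R, hR, rfl⟩ n
    refine ((hR.dominated_zero n).comp_right L).mono fun v x => ?_
    simp only [Function.comp_apply]
    gcongr
    exact hω x
  · rintro _ ⟨R, hR, rfl⟩ j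
    refine ⟨∑ i, (L (EuclideanSpace.single j 1) i : ℂ) • fun v => UltraDiff.dPartial i (R v),
      sum fun i _ => (hR.dPartial i).const_smul _, ?_⟩
    ext v x
    simp [dPartial_comp_clm ((hR.contDiff v).differentiable (by simp))]

lemma coord_mul (hT : ControlledDecay ω T) (j : ι) :
    ControlledDecay ω fun v x => x j * T v x := by
  classical
  obtain ⟨k, C, hC⟩ := exists_one_add_norm_pow_le ω 1
  refine of_dPartial_mem (𝒞 := {S | ∃ R R', ControlledDecay ω R ∧ ControlledDecay ω R' ∧
    S = fun v x => x j * R v x + R' v x}) ?_ ?_ ?_ ⟨T, 0, hT, zero, by simp⟩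
  · rintro _ ⟨R, R', hR, hR', rfl⟩ v
    exact ((contDiff_coord j).mul (hR.contDiff v)).add (hR'.contDiff v)
  · rintro _ ⟨R, R', hR, hR', rfl⟩ n
    refine (((hR.dominated_zero (n + k)).const_mul C.toNNReal).add (hR'.dominated_zero n)).mono
      fun v x => ?_
    have hx : ‖x j‖ ≤ C.toNNReal * Real.exp (k * directSum ω x) :=
      calc ‖x j‖ ≤ ‖x‖ := PiLp.norm_apply_le x j
        _ ≤ (1 + ‖x‖) ^ 1 := by simp
        _ ≤ C * Real.exp (k * directSum ω x) := hC x
        _ ≤ _ := by gcongr; exact Real.le_coe_toNNReal C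
    calc Real.exp (n * directSum ω x) * ‖x j * R v x + R' v x‖
        ≤ Real.exp (n * directSum ω x) * (‖x j‖ * ‖R v x‖ + ‖R' v x‖) := by
          gcongr
          exact (norm_add_le _ _).trans_eq (by rw [norm_mul, norm_real])
      _ ≤ Real.exp (n * directSum ω x) *
            (C.toNNReal * Real.exp (k * directSum ω x) * ‖R v x‖ + ‖R' v x‖) := by
          gcongr
      _ = _ := by
          rw [Nat.cast_add, add_mul, Real.exp_add]
          ring
  · rintro _ ⟨R, R', hR, hR', rfl⟩ i
    refine ⟨_, _, hR.dPartial i, (hR.const_smul (if i = j then -I else 0)).add (hR'.dPartial i), ?_⟩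
    ext v x
    change UltraDiff.dPartial i ((fun x => x j * R v x) + R' v) x = _
    rw [dPartial_add i ((contDiff_coord j).mul (hR.contDiff v)) (hR'.contDiff v), Pi.add_apply,
      dPartial_coord_mul ((hR.contDiff v).differentiable (by simp))]
    simp only [Pi.add_apply, Pi.smul_apply, smul_eq_mul]
    ring

lemma of_hasFDerivAt {S : ι → V →L[ℂ] V}
    (hT : ∀ v x, HasFDerivAt (T v) (∑ j, T (S j v) x • coordI j) x)
    (hdom : ∀ n : ℕ, SeminormDominated fun v x => Real.exp (n * directSum ω x) * ‖T v x‖) :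
    ControlledDecay ω T := by
  refine of_dPartial_mem (𝒞 := {R | ∃ A : V →L[ℂ] V, R = fun v => T (A v)}) ?_ ?_ ?_
    ⟨ContinuousLinearMap.id ℂ V, rfl⟩
  · rintro _ ⟨A, rfl⟩ v
    exact contDiff_of_hasFDerivAt_coordI hT (A v)
  · rintro _ ⟨A, rfl⟩ n
    exact (hdom n).comp A
  · rintro _ ⟨A, rfl⟩ j
    exact ⟨S j ∘L A, funext fun v => funext fun x => dPartial_eq_of_hasFDerivAt (hT (A v) x) j⟩

end ControlledDecay

end ControlledDecay

namespace Swo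

variable {ι κ : Type} [Fintype ι] [Fintype κ] {ω σ : ι → WeightFunction}

lemma integrable (f : Swo ω σ) : Integrable f := f.2.1

lemma contDiff (f : Swo ω σ) : ContDiff ℝ (⊤ : ℕ∞) f := f.2.2.1.1

lemma controlledDecay_coe (ω σ : ι → WeightFunction) :
    ControlledDecay ω fun f : Swo ω σ => (f : EuclideanSpace ℝ ι → ℂ) where
  contDiff := contDiff
  dominated n α := ⟨swoSeminorm ω σ (Sum.inl (n, α)),
    (swo_withSeminorms ω σ).continuous_seminorm _, fun f => le_ciSup (f.2.2.1.bddAbove n α)⟩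

lemma controlledDecay_fourierT (ω σ : ι → WeightFunction) :
    ControlledDecay σ fun f : Swo ω σ => fourierT f where
  contDiff f := f.2.2.2.1
  dominated n α := ⟨swoSeminorm ω σ (Sum.inr (n, α)),
    (swo_withSeminorms ω σ).continuous_seminorm _, fun f => le_ciSup (f.2.2.2.bddAbove n α)⟩

variable {V : Type*} [AddCommGroup V] [Module ℂ V] [TopologicalSpace V] [IsTopologicalAddGroup V]
  {ω' σ' : κ → WeightFunction}

/-- The continuous linear map into `𝒮_Ω^Σ` given by a linear family of functions such that the
family and its Fourier transform have controlled decay. -/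
def liftCLM (T : V → EuclideanSpace ℝ κ → ℂ) (hadd : ∀ v w, T (v + w) = T v + T w)
    (hsmul : ∀ (c : ℂ) v, T (c • v) = c • T v) (hT : ControlledDecay ω' T)
    (hT' : ControlledDecay σ' fun v => fourierT (T v)) : V →L[ℂ] Swo ω' σ' :=
  let S : V →ₗ[ℂ] Swo ω' σ' :=
    { toFun := fun v => ⟨T v, hT.integrable v, hT.weightedDecay v, hT'.weightedDecay v⟩
      map_add' := fun v w => Subtype.ext (hadd v w)
      map_smul' := fun c v => Subtype.ext (hsmul c v) }
  { toLinearMap := S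
    cont := by
      refine (swo_withSeminorms ω' σ').continuous_of_continuous_comp S fun i => ?_
      obtain ⟨n, α⟩ | ⟨n, α⟩ := i
      · obtain ⟨q, hq, hb⟩ := hT.dominated n α
        exact Seminorm.continuous_of_le hq fun v => ciSup_le (hb v)
      · obtain ⟨q, hq, hb⟩ := hT'.dominated n α
        exact Seminorm.continuous_of_le hq fun v => ciSup_le (hb v) }

end Swo

lemma integrable_sum_smul_const {α β G : Type*} [MeasurableSpace α] {μ : Measure α} [Fintype β]
    [NormedAddCommGroup G] [NormedSpace ℂ G] {a : β → α → ℂ} (ha : ∀ j, Integrable (a j) μ)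
    (L : β → G) : Integrable (fun y => ∑ j, a j y • L j) μ :=
  integrable_finsetSum _ fun j _ => (ha j).smul_const (L j)

section FourierTransform

variable {ι κ : Type} [Fintype ι] [Fintype κ] {f g : EuclideanSpace ℝ ι → ℂ}

/-- The bilinear form `(x, ξ) ↦ x ξ / 2π`, which turns Mathlib's normalisation
`exp(-2πi L(x, ξ))` of the Fourier kernel into that of `fourierT`. -/
def fourierForm (ι : Type) [Fintype ι] :
    EuclideanSpace ℝ ι →L[ℝ] EuclideanSpace ℝ ι →L[ℝ] ℝ :=
  (2 * Real.pi)⁻¹ • innerSL ℝ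

lemma fourierForm_apply (x ξ : EuclideanSpace ℝ ι) :
    fourierForm ι x ξ = (2 * Real.pi)⁻¹ * inner ℝ x ξ :=
  rfl

lemma fourierForm_eq_inner_smul (x ξ : EuclideanSpace ℝ ι) :
    fourierForm ι x ξ = inner ℝ x ((2 * Real.pi)⁻¹ • ξ) := by
  rw [fourierForm_apply, real_inner_smul_right]

lemma fourierChar_neg_fourierForm (x ξ : EuclideanSpace ℝ ι) :
    (Real.fourierChar (-fourierForm ι x ξ) : ℂ) = exp (-(I * (inner ℝ x ξ : ℝ))) := by
  have hpi : (Real.pi : ℂ) ≠ 0 := ofReal_ne_zero.2 Real.pi_ne_zero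
  rw [Real.fourierChar_apply, fourierForm_apply]
  push_cast
  field_simp

lemma fourierT_eq_fourierIntegral (f : EuclideanSpace ℝ ι → ℂ) :
    fourierT f = VectorFourier.fourierIntegral Real.fourierChar volume
      (fourierForm ι).toLinearMap₁₂ f := by
  ext ξ
  refine integral_congr_ae (ae_of_all _ fun x => ?_)
  change _ = Real.fourierChar (-fourierForm ι x ξ) • f x
  rw [Circle.smul_def, fourierChar_neg_fourierForm, smul_eq_mul]

lemma fourierT_eq_fourier (f : EuclideanSpace ℝ ι → ℂ) (ξ : EuclideanSpace ℝ ι) :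
    fourierT f ξ = 𝓕 f ((2 * Real.pi)⁻¹ • ξ) := by
  simp only [fourierT, Real.fourier_eq, Circle.smul_def, smul_eq_mul, ← fourierForm_eq_inner_smul,
    fourierChar_neg_fourierForm]

lemma fourierT_fourierT (hf : Continuous f) (hfi : Integrable f) (hfi' : Integrable (fourierT f))
    (x : EuclideanSpace ℝ ι) :
    fourierT (fourierT f) x = (2 * Real.pi) ^ Fintype.card ι * f (-x) := by
  have hpi : 2 * Real.pi ≠ 0 := by positivity
  have fourier_eq (y) : 𝓕 f y = fourierT f ((2 * Real.pi) • y) := by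
    rw [fourierT_eq_fourier, smul_smul, inv_mul_cancel₀ hpi, one_smul]
  have hfourier : Integrable (𝓕 f) := (funext fourier_eq : 𝓕 f = _) ▸ hfi'.comp_smul hpi
  have kernel_eq (y) : exp (-(I * (inner ℝ ((2 * Real.pi) • y) x : ℝ))) =
      Real.fourierChar (inner ℝ y (-x)) := by
    rw [real_inner_smul_left, Real.fourierChar_apply, inner_neg_right]
    push_cast
    ring_nf
  calc fourierT (fourierT f) x
      = ∫ y, exp (-(I * (inner ℝ ((2 * Real.pi) • (2 * Real.pi)⁻¹ • y) x : ℝ))) *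
          𝓕 f ((2 * Real.pi)⁻¹ • y) := by
        simp only [fourierT, smul_inv_smul₀ hpi, ← fourierT_eq_fourier]
    _ = (2 * Real.pi) ^ Fintype.card ι *
          ∫ y, exp (-(I * (inner ℝ ((2 * Real.pi) • y) x : ℝ))) * 𝓕 f y := by
        rw [Measure.integral_comp_inv_smul volume
          fun y => exp (-(I * (inner ℝ ((2 * Real.pi) • y) x : ℝ))) * 𝓕 f y]
        simp [abs_of_pos Real.pi_pos]
    _ = (2 * Real.pi) ^ Fintype.card ι * 𝓕⁻ (𝓕 f) (-x) := by
        simp only [Real.fourierInv_eq, Circle.smul_def, smul_eq_mul, kernel_eq]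
    _ = (2 * Real.pi) ^ Fintype.card ι * f (-x) := by
        rw [hf.fourierInv_fourier_eq hfi hfourier]

lemma integral_mul_fourierT (hf : Integrable f) (hg : Integrable g) :
    ∫ x, f x * fourierT g x = ∫ x, fourierT f x * g x := by
  have hflip : (fourierForm ι).toLinearMap₁₂.flip = (fourierForm ι).toLinearMap₁₂ := by
    ext x y
    change fourierForm ι y x = fourierForm ι x y
    rw [fourierForm_apply, fourierForm_apply, real_inner_comm]
  have h := VectorFourier.integral_fourierIntegral_smul_eq_flip (μ := volume) (ν := volume)
    (L := (fourierForm ι).toLinearMap₁₂) Real.continuous_fourierChar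
    (fourierForm ι).continuous₂ hf hg
  rw [hflip, ← fourierT_eq_fourierIntegral, ← fourierT_eq_fourierIntegral] at h
  exact h.symm

lemma integrable_fderiv (hf : Differentiable ℝ f) (hf' : ∀ j, Integrable (dPartial j f)) :
    Integrable (fderiv ℝ f) := by
  have hfderiv : fderiv ℝ f = fun x => ∑ j, dPartial j f x • coordI j :=
    funext fun x => (hasFDerivAt_sum_dPartial (hf x)).fderiv
  rw [hfderiv]
  exact integrable_sum_smul_const hf' coordI

lemma fourierT_dPartial (hf : Differentiable ℝ f) (hfi : Integrable f)
    (hf' : ∀ j, Integrable (dPartial j f)) (j : ι) :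
    fourierT (dPartial j f) = fun ξ => ξ j * fourierT f ξ := by
  classical
  ext ξ
  have hpi : (Real.pi : ℂ) ≠ 0 := ofReal_ne_zero.2 Real.pi_ne_zero
  have hi := integrable_fderiv hf hf'
  have h := congrArg (· (EuclideanSpace.single j 1))
    (congrFun (VectorFourier.fourierIntegral_fderiv (fourierForm ι) hfi hf hi) ξ)
  simp only [Real.fourierIntegral_continuousLinearMap_apply' hi,
    ← fourierT_eq_fourierIntegral] at h
  have hj : dPartial j f = (-I) • fun x => fderiv ℝ f x (EuclideanSpace.single j 1) :=
    funext (dPartial_apply j f)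
  rw [hj, fourierT_smul, Pi.smul_apply, h]
  simp only [VectorFourier.fourierSMulRight_apply, neg_apply, ContinuousLinearMap.flip_apply,
    fourierForm_apply, EuclideanSpace.inner_single_left, Real.ringHom_apply, one_mul, neg_smul,
    real_smul, ofReal_mul, ofReal_inv, ofReal_ofNat, smul_eq_mul]
  field_simp
  rw [I_sq]
  ring

lemma fourierT_comp_linearIsometryEquiv (f : EuclideanSpace ℝ ι → ℂ)
    (L : EuclideanSpace ℝ κ ≃ₗᵢ[ℝ] EuclideanSpace ℝ ι) :
    fourierT (f ∘ L) = fourierT f ∘ L := by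
  ext ξ
  rw [fourierT_eq_fourier, Real.fourier_comp_linearIsometry, map_smul, ← fourierT_eq_fourier,
    Function.comp_apply]

end FourierTransform

namespace Swo

variable {ι κ : Type} [Fintype ι] [Fintype κ]

lemma fourierT_fourierT {ω σ : ι → WeightFunction} (f : Swo ω σ) :
    fourierT (fourierT f) =
      ((2 * Real.pi) ^ Fintype.card ι : ℂ) • (f ∘ LinearIsometryEquiv.neg ℝ) :=
  funext <| UltraDiff.fourierT_fourierT f.contDiff.continuous f.integrable
    ((controlledDecay_fourierT ω σ).integrable f)

variable (ω σ : ι → WeightFunction)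

/-- Composition with a linear isometry, between spaces `𝒮_Ω^Σ` with compatible weights. -/
def compIsometryCLM {ω' σ' : κ → WeightFunction}
    (L : EuclideanSpace ℝ κ ≃ₗᵢ[ℝ] EuclideanSpace ℝ ι)
    (hω : ∀ x, directSum ω' x ≤ directSum ω (L x))
    (hσ : ∀ x, directSum σ' x ≤ directSum σ (L x)) : Swo ω σ →L[ℂ] Swo ω' σ' :=
  liftCLM (fun f => f ∘ L) (fun _ _ => rfl) (fun _ _ => rfl)
    ((controlledDecay_coe ω σ).comp_clm
      L.toContinuousLinearEquiv.toContinuousLinearMap hω) <| by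
      simp only [fourierT_comp_linearIsometryEquiv]
      exact (controlledDecay_fourierT ω σ).comp_clm
        L.toContinuousLinearEquiv.toContinuousLinearMap hσ

/-- The reflection `f ↦ f(-·)`. -/
def reflectionCLM : Swo ω σ →L[ℂ] Swo ω σ :=
  compIsometryCLM ω σ (LinearIsometryEquiv.neg ℝ) (fun x => by simp [directSum])
    (fun x => by simp [directSum])

/-- The Fourier transform `f ↦ ∫ exp(-i x ξ) f(x) dx` between the spaces `𝒮_Ω^Σ` and `𝒮_Σ^Ω`. -/
def fourierCLM : Swo ω σ →L[ℂ] Swo σ ω :=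
  liftCLM (fun f => fourierT f) (fun f g => fourierT_add f.integrable g.integrable)
    (fun c f => fourierT_smul c f) (controlledDecay_fourierT ω σ) <| by
      simp only [fourierT_fourierT]
      exact ((controlledDecay_coe ω σ).comp (reflectionCLM ω σ)).const_smul _

/-- The inverse of `fourierCLM ω σ`. -/
def fourierInvCLM : Swo σ ω →L[ℂ] Swo ω σ :=
  ((2 * Real.pi) ^ Fintype.card ι : ℂ)⁻¹ • (reflectionCLM ω σ ∘L fourierCLM σ ω)

lemma fourierT_fourierInvCLM (f : Swo σ ω) : fourierT (fourierInvCLM ω σ f) = f := by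
  have hpi : ((2 * Real.pi) ^ Fintype.card ι : ℂ) ≠ 0 :=
    pow_ne_zero _ (mul_ne_zero two_ne_zero (ofReal_ne_zero.2 Real.pi_ne_zero))
  change fourierT (((2 * Real.pi) ^ Fintype.card ι : ℂ)⁻¹ •
    (fourierT f ∘ LinearIsometryEquiv.neg ℝ)) = f
  rw [fourierT_smul, fourierT_comp_linearIsometryEquiv, fourierT_fourierT]
  ext x
  simp [hpi]

variable {ω σ} in
lemma fourierT_dPartial (f : Swo ω σ) (j : ι) :
    fourierT (dPartial j f) = fun ξ => ξ j * fourierT f ξ :=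
  UltraDiff.fourierT_dPartial (f.contDiff.differentiable (by simp)) f.integrable
    (fun j => ((controlledDecay_coe ω σ).dPartial j).integrable f) j

/-- The operator `D_j` on `𝒮_Ω^Σ`. -/
def dPartialCLM (j : ι) : Swo ω σ →L[ℂ] Swo ω σ :=
  liftCLM (fun f => dPartial j f) (fun f g => dPartial_add j f.contDiff g.contDiff)
    (fun c f => dPartial_smul j c f.contDiff) ((controlledDecay_coe ω σ).dPartial j) <| by
      simpa only [fourierT_dPartial] using (controlledDecay_fourierT ω σ).coord_mul j

/-- Multiplication by the `j`-th coordinate, as the conjugate of `D_j` by the Fourier transform. -/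
def coordMulCLM (j : ι) : Swo ω σ →L[ℂ] Swo ω σ :=
  fourierCLM σ ω ∘L dPartialCLM σ ω j ∘L fourierInvCLM σ ω

lemma coe_coordMulCLM (j : ι) (f : Swo ω σ) :
    (coordMulCLM ω σ j f : EuclideanSpace ℝ ι → ℂ) = fun x => x j * f x := by
  change fourierT (dPartial j (fourierInvCLM σ ω f)) = _
  rw [fourierT_dPartial, fourierT_fourierInvCLM]

end Swo

section Blocks

variable {N : ℕ}

@[simp]
lemma fstBlock_pair (x y : EuclideanSpace ℝ (Fin N)) : fstBlock (pair x y) = x :=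
  rfl

@[simp]
lemma sndBlock_pair (x y : EuclideanSpace ℝ (Fin N)) : sndBlock (pair x y) = y :=
  rfl

@[simp]
lemma pair_fstBlock_sndBlock (z : R2 N) : pair (fstBlock z) (sndBlock z) = z := by
  ext (i | i) <;> rfl

lemma continuous_pair : Continuous
    fun p : EuclideanSpace ℝ (Fin N) × EuclideanSpace ℝ (Fin N) => pair p.1 p.2 := by
  refine (PiLp.continuous_toLp 2 _).comp (continuous_pi fun i => ?_)
  rcases i with i | i <;> dsimp only [Sum.elim_inl, Sum.elim_inr] <;> fun_prop

lemma measurePreserving_pair : MeasurePreserving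
    fun p : EuclideanSpace ℝ (Fin N) × EuclideanSpace ℝ (Fin N) => pair p.1 p.2 := by
  have hofLp := EuclideanSpace.volume_preserving_symm_measurableEquiv_toLp (Fin N)
  convert! (EuclideanSpace.volume_preserving_symm_measurableEquiv_toLp _).symm.comp
    ((volume_measurePreserving_sumPiEquivProdPi_symm fun _ : Fin N ⊕ Fin N => ℝ).comp
      (hofLp.prod hofLp)) using 1

lemma measurableEmbedding_pair : MeasurableEmbedding
    fun p : EuclideanSpace ℝ (Fin N) × EuclideanSpace ℝ (Fin N) => pair p.1 p.2 := by
  refine continuous_pair.measurableEmbedding fun p q h => ?_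
  exact Prod.ext (congrArg fstBlock h) (congrArg sndBlock h)

lemma integral_eq_integral_integral_pair {G : R2 N → ℂ} (hG : Integrable G) :
    ∫ z, G z = ∫ x : EuclideanSpace ℝ (Fin N), ∫ y : EuclideanSpace ℝ (Fin N), G (pair x y) := by
  rw [← measurePreserving_pair.integral_comp measurableEmbedding_pair]
  exact integral_prod _ ((measurePreserving_pair.integrable_comp_emb measurableEmbedding_pair).2 hG)

lemma inner_pair (x y : EuclideanSpace ℝ (Fin N)) (z : R2 N) :
    inner ℝ (pair x y) z = inner ℝ x (fstBlock z) + inner ℝ y (sndBlock z) := by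
  simp only [PiLp.inner_apply, Fintype.sum_sum_type]
  rfl

lemma directSum_eq_add (ω : Fin N ⊕ Fin N → WeightFunction) (z : R2 N) :
    directSum ω z =
      directSum (ω ∘ Sum.inl) (fstBlock z) + directSum (ω ∘ Sum.inr) (sndBlock z) := by
  simp only [directSum, Fintype.sum_sum_type]
  rfl

lemma mixWeights_mixWeights (ω σ : Fin N ⊕ Fin N → WeightFunction) :
    mixWeights (mixWeights ω σ) (mixWeights σ ω) = ω := by
  ext1 (i | i) <;> rfl

/-- The exchange `(x, y) ↦ (y, x)` of the two blocks of variables. It transfers statements about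
the second block to the first one. -/
def swapBlocks (N : ℕ) : R2 N ≃ₗᵢ[ℝ] R2 N :=
  LinearIsometryEquiv.piLpCongrLeft 2 ℝ ℝ (Equiv.sumComm (Fin N) (Fin N))

@[simp]
lemma swapBlocks_pair (x y : EuclideanSpace ℝ (Fin N)) : swapBlocks N (pair x y) = pair y x := by
  ext (i | i) <;> rfl

@[simp]
lemma fstBlock_swapBlocks (z : R2 N) : fstBlock (swapBlocks N z) = sndBlock z :=
  rfl

@[simp]
lemma sndBlock_swapBlocks (z : R2 N) : sndBlock (swapBlocks N z) = fstBlock z :=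
  rfl

@[simp]
lemma swapBlocks_swapBlocks (z : R2 N) : swapBlocks N (swapBlocks N z) = z := by
  ext (i | i) <;> rfl

lemma directSum_comp_swapBlocks (ω : Fin N ⊕ Fin N → WeightFunction) (z : R2 N) :
    directSum (ω ∘ Sum.swap) z = directSum ω (swapBlocks N z) := by
  simp only [directSum_eq_add, fstBlock_swapBlocks, sndBlock_swapBlocks]
  exact add_comm _ _

end Blocks

section PartialFourier

variable {N : ℕ}

lemma partialFourier₁_apply (F : R2 N → ℂ) (z : R2 N) :
    partialFourier₁ F z = fourierT (fun x => F (pair x (sndBlock z))) (fstBlock z) :=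
  rfl

lemma partialFourier₂_apply (F : R2 N → ℂ) (z : R2 N) :
    partialFourier₂ F z = fourierT (fun y => F (pair (fstBlock z) y)) (sndBlock z) :=
  rfl

lemma partialFourier₁_comp_swapBlocks (F : R2 N → ℂ) :
    partialFourier₁ (F ∘ swapBlocks N) = partialFourier₂ F ∘ swapBlocks N := by
  ext z
  simp [partialFourier₁_apply, partialFourier₂_apply]

lemma partialFourier₂_comp_swapBlocks (F : R2 N → ℂ) :
    partialFourier₂ (F ∘ swapBlocks N) = partialFourier₁ F ∘ swapBlocks N := by
  ext z
  simp [partialFourier₁_apply, partialFourier₂_apply]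

lemma fourierT_eq_partialFourier₁_partialFourier₂ {F : R2 N → ℂ} (hF : Integrable F) :
    fourierT F = partialFourier₁ (partialFourier₂ F) := by
  ext z
  rw [fourierT, integral_eq_integral_integral_pair (exp_fourier_integrable hF z)]
  simp only [partialFourier₁, partialFourier₂, inner_pair, ofReal_add, mul_add, neg_add,
    Complex.exp_add, mul_assoc, integral_const_mul, fstBlock_pair, sndBlock_pair]

lemma fourierT_eq_partialFourier₂_partialFourier₁ {F : R2 N → ℂ} (hF : Integrable F) :
    fourierT F = partialFourier₂ (partialFourier₁ F) := by
  have hswap : Integrable (F ∘ swapBlocks N) :=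
    ((swapBlocks N).measurePreserving.integrable_comp_emb
      (swapBlocks N).toHomeomorph.measurableEmbedding).2 hF
  have h := fourierT_eq_partialFourier₁_partialFourier₂ hswap
  rw [fourierT_comp_linearIsometryEquiv, partialFourier₂_comp_swapBlocks,
    partialFourier₁_comp_swapBlocks] at h
  exact (swapBlocks N).surjective.injective_comp_right h

lemma norm_fourierT_le {ι : Type} [Fintype ι] (f : EuclideanSpace ℝ ι → ℂ)
    (ξ : EuclideanSpace ℝ ι) : ‖fourierT f ξ‖ ≤ ∫ x, ‖f x‖ := by
  rw [fourierT_eq_fourierIntegral]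
  exact VectorFourier.norm_fourierIntegral_le_integral_norm _ _ _ _ _

end PartialFourier

namespace ControlledDecay

variable {N : ℕ} {V : Type*} [AddCommGroup V] [Module ℂ V] [TopologicalSpace V]
  {ω : Fin N ⊕ Fin N → WeightFunction} {T : V → R2 N → ℂ}

lemma comp_swapBlocks (hT : ControlledDecay ω T) :
    ControlledDecay (ω ∘ Sum.swap) fun v => T v ∘ swapBlocks N :=
  hT.comp_clm (swapBlocks N).toContinuousLinearEquiv.toContinuousLinearMap
    fun z => (directSum_comp_swapBlocks ω z).le

lemma exists_slice_bound (hT : ControlledDecay ω T) (n : ℕ) :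
    ∃ q : Seminorm ℂ V, Continuous q ∧ ∃ g : EuclideanSpace ℝ (Fin N) → ℝ, Integrable g ∧
      ∀ v x y, Real.exp (n * directSum (ω ∘ Sum.inl) x) * ‖T v (pair x y)‖ ≤ q v * g y := by
  obtain ⟨k, hk⟩ := exists_integrable_exp_neg (ω ∘ Sum.inr)
  obtain ⟨q, hq, hb⟩ := hT.dominated_zero (n + k)
  refine ⟨q, hq, _, hk, fun v x y => le_mul_exp_neg (le_trans ?_ (hb v (pair x y)))⟩
  have hx := directSum_nonneg (ω ∘ Sum.inl) x
  have hy := directSum_nonneg (ω ∘ Sum.inr) y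
  rw [← mul_assoc, ← Real.exp_add]
  refine mul_le_mul_of_nonneg_right (Real.exp_le_exp.2 ?_) (norm_nonneg _)
  rw [directSum_eq_add, fstBlock_pair, sndBlock_pair, Nat.cast_add]
  nlinarith [mul_nonneg k.cast_nonneg hx, mul_nonneg n.cast_nonneg hy]

lemma integrable_slice_snd (hT : ControlledDecay ω T) (v : V) (x : EuclideanSpace ℝ (Fin N)) :
    Integrable fun y => T v (pair x y) := by
  obtain ⟨q, -, g, hg, hb⟩ := hT.exists_slice_bound 0
  refine (hg.const_mul (q v)).mono' ((hT.contDiff v).continuous.comp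
    (continuous_pair.comp (Continuous.prodMk_right x))).aestronglyMeasurable
    (ae_of_all _ fun y => ?_)
  simpa using hb v x y

lemma integrable_slice_fst (hT : ControlledDecay ω T) (v : V) (y : EuclideanSpace ℝ (Fin N)) :
    Integrable fun x => T v (pair x y) := by
  simpa using hT.comp_swapBlocks.integrable_slice_snd v y

lemma dominated_partialFourier₂ (hT : ControlledDecay ω T) (n : ℕ) :
    SeminormDominated fun v z =>
      Real.exp (n * directSum (ω ∘ Sum.inl) (fstBlock z)) * ‖partialFourier₂ (T v) z‖ := by
  obtain ⟨q, hq, g, hg, hb⟩ := hT.exists_slice_bound n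
  refine ⟨‖∫ y, g y‖₊ • q, continuous_const.mul hq, fun v z => ?_⟩
  set x := fstBlock z
  calc Real.exp (n * directSum (ω ∘ Sum.inl) x) * ‖partialFourier₂ (T v) z‖
      ≤ Real.exp (n * directSum (ω ∘ Sum.inl) x) * ∫ y, ‖T v (pair x y)‖ := by
        rw [partialFourier₂_apply]
        gcongr
        exact norm_fourierT_le _ _
    _ = ∫ y, Real.exp (n * directSum (ω ∘ Sum.inl) x) * ‖T v (pair x y)‖ :=
        (integral_const_mul _ _).symm
    _ ≤ ∫ y, q v * g y :=
        integral_mono ((hT.integrable_slice_snd v x).norm.const_mul _) (hg.const_mul _) (hb v x)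
    _ = (∫ y, g y) * q v := by rw [integral_const_mul, mul_comm]
    _ ≤ ‖∫ y, g y‖₊ * q v := by
        gcongr
        exact Real.le_norm_self _

lemma dominated_partialFourier₁ (hT : ControlledDecay ω T) (n : ℕ) :
    SeminormDominated fun v z =>
      Real.exp (n * directSum (ω ∘ Sum.inr) (sndBlock z)) * ‖partialFourier₁ (T v) z‖ := by
  have h := (hT.comp_swapBlocks.dominated_partialFourier₂ n).comp_right (swapBlocks N)
  simp only [partialFourier₂_comp_swapBlocks, Function.comp_apply, swapBlocks_swapBlocks,
    fstBlock_swapBlocks] at h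
  exact h

end ControlledDecay

section Derivative

variable {N : ℕ}

/-- The projection `(x, y) ↦ (x, 0)` of `ℝ^{2N}`. -/
def fstBlockProj (N : ℕ) : R2 N →L[ℝ] R2 N :=
  LinearMap.toContinuousLinearMap
    { toFun := fun z => pair (fstBlock z) 0
      map_add' := fun z w => by ext (i | i) <;> simp [pair, fstBlock]
      map_smul' := fun c z => by ext (i | i) <;> simp [pair, fstBlock] }

lemma pair_fstBlock_eq_fstBlockProj_add (z : R2 N) (y : EuclideanSpace ℝ (Fin N)) :
    pair (fstBlock z) y = fstBlockProj N z + pair 0 y := by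
  ext (i | i) <;> simp [fstBlockProj, pair]

lemma coordI_inl_comp_fstBlockProj (j : Fin N) :
    coordI (Sum.inl j) ∘L fstBlockProj N = coordI (Sum.inl j) :=
  rfl

lemma coordI_inr_comp_fstBlockProj (j : Fin N) :
    coordI (Sum.inr j) ∘L fstBlockProj N = 0 := by
  ext z
  simp [fstBlockProj, pair]

/-- The operators which the partial Fourier transform in the second block turns into the
operators `D_j`: again `D_j` for a variable of the first block, and multiplication by `-z_j` for a
variable of the second one. -/
def preDeriv (f : R2 N → ℂ) : Fin N ⊕ Fin N → R2 N → ℂ :=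
  Sum.elim (fun j => dPartial (Sum.inl j) f) (fun j z => -(z (Sum.inr j) * f z))

lemma hasFDerivAt_comp_pair_fstBlock {f : R2 N → ℂ} (hf : Differentiable ℝ f)
    (y : EuclideanSpace ℝ (Fin N)) (z : R2 N) :
    HasFDerivAt (fun z => f (pair (fstBlock z) y))
      (∑ j, dPartial (Sum.inl j) f (pair (fstBlock z) y) • coordI (Sum.inl j)) z := by
  have hpair : HasFDerivAt (fun z : R2 N => pair (fstBlock z) y) (fstBlockProj N) z := by
    simp only [pair_fstBlock_eq_fstBlockProj_add]
    exact (fstBlockProj N).hasFDerivAt.add_const _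
  convert! (hasFDerivAt_sum_dPartial (hf (pair (fstBlock z) y))).comp z hpair using 1
  simp only [Fintype.sum_sum_type, ContinuousLinearMap.add_comp,
    ContinuousLinearMap.finsetSum_comp, ContinuousLinearMap.smul_comp,
    coordI_inl_comp_fstBlockProj, coordI_inr_comp_fstBlockProj, smul_zero,
    Finset.sum_const_zero, add_zero]

lemma hasFDerivAt_exp_inner_sndBlock (y : EuclideanSpace ℝ (Fin N)) (z : R2 N) :
    HasFDerivAt (fun z : R2 N => exp (-(I * (inner ℝ y (sndBlock z) : ℝ))))
      (∑ j, (-(y j * exp (-(I * (inner ℝ y (sndBlock z) : ℝ))))) • coordI (Sum.inr j)) z := by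
  have hlin : (fun z : R2 N => -(I * (inner ℝ y (sndBlock z) : ℝ))) =
      ⇑(∑ j, (-(y j : ℂ)) • (coordI (Sum.inr j) : R2 N →L[ℝ] ℂ)) := by
    ext z
    simp only [PiLp.inner_apply, sndBlock, sum_apply, smul_apply, coordI_apply, smul_eq_mul,
      RCLike.inner_apply, conj_trivial, ofReal_sum, ofReal_mul, Finset.mul_sum,
      ← Finset.sum_neg_distrib]
    exact Finset.sum_congr rfl fun j _ => by ring
  have h := (∑ j, (-(y j : ℂ)) • (coordI (Sum.inr j) : R2 N →L[ℝ] ℂ)).hasFDerivAt (x := z)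
  rw [← hlin] at h
  convert! h.cexp using 1
  rw [Finset.smul_sum]
  refine Finset.sum_congr rfl fun j _ => ?_
  rw [smul_smul]
  ring_nf

lemma hasFDerivAt_partialFourier₂_integrand {f : R2 N → ℂ} (hf : Differentiable ℝ f)
    (y : EuclideanSpace ℝ (Fin N)) (z : R2 N) :
    HasFDerivAt
      (fun z => exp (-(I * (inner ℝ y (sndBlock z) : ℝ))) * f (pair (fstBlock z) y))
      (∑ j, (exp (-(I * (inner ℝ y (sndBlock z) : ℝ))) * preDeriv f j (pair (fstBlock z) y)) •
        coordI j) z := by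
  convert! (hasFDerivAt_exp_inner_sndBlock y z).mul (hasFDerivAt_comp_pair_fstBlock hf y z) using 1
  simp only [Fintype.sum_sum_type, Finset.smul_sum, smul_smul, preDeriv, Sum.elim_inl,
    Sum.elim_inr]
  congr 1
  refine Finset.sum_congr rfl fun j _ => ?_
  congr 1
  change _ * -(y j * f _) = _
  ring

lemma integral_sum_smul_const {α β G : Type*} [MeasurableSpace α] {μ : Measure α} [Fintype β]
    [NormedAddCommGroup G] [NormedSpace ℝ G] [NormedSpace ℂ G] [CompleteSpace G]
    {a : β → α → ℂ} (ha : ∀ j, Integrable (a j) μ) (L : β → G) :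
    ∫ y, ∑ j, a j y • L j ∂μ = ∑ j, (∫ y, a j y ∂μ) • L j := by
  rw [integral_finsetSum _ fun j _ => (ha j).smul_const (L j)]
  exact Finset.sum_congr rfl fun j _ => integral_smul_const _ _

lemma hasFDerivAt_partialFourier₂ {f : R2 N → ℂ} (hf : Differentiable ℝ f)
    (hfi : ∀ x, Integrable fun y => f (pair x y))
    (hfi' : ∀ j x, Integrable fun y => preDeriv f j (pair x y))
    {g : Fin N ⊕ Fin N → EuclideanSpace ℝ (Fin N) → ℝ} (hg : ∀ j, Integrable (g j))
    (hfg : ∀ j x y, ‖preDeriv f j (pair x y)‖ ≤ g j y) (z : R2 N) :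
    HasFDerivAt (partialFourier₂ f) (∑ j, partialFourier₂ (preDeriv f j) z • coordI j) z := by
  have hint (z : R2 N) := exp_fourier_integrable (hfi (fstBlock z)) (sndBlock z)
  have hint' (j) := exp_fourier_integrable (hfi' j (fstBlock z)) (sndBlock z)
  have hbound (y : EuclideanSpace ℝ (Fin N)) (z : R2 N) :
      ‖∑ j, (exp (-(I * (inner ℝ y (sndBlock z) : ℝ))) * preDeriv f j (pair (fstBlock z) y)) •
        (coordI j : R2 N →L[ℝ] ℂ)‖ ≤ ∑ j, g j y * ‖(coordI j : R2 N →L[ℝ] ℂ)‖ := by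
    refine norm_sum_le_of_le _ fun j _ => ?_
    rw [norm_smul, norm_mul, ← mul_neg, ← ofReal_neg, norm_exp_I_mul_ofReal, one_mul]
    gcongr
    exact hfg j _ y
  unfold partialFourier₂
  rw [← integral_sum_smul_const hint' coordI]
  exact hasFDerivAt_integral_of_dominated_of_fderiv_le univ_mem
    (Eventually.of_forall fun z => (hint z).aestronglyMeasurable) (hint z)
    (integrable_sum_smul_const hint' coordI).aestronglyMeasurable
    (ae_of_all _ fun y z _ => hbound y z)
    (integrable_finsetSum _ fun j _ => (hg j).mul_const _)
    (ae_of_all _ fun y z _ => hasFDerivAt_partialFourier₂_integrand hf y z)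

end Derivative

namespace Swo

variable {N : ℕ} (ω σ : Fin N ⊕ Fin N → WeightFunction)

/-- The operators `preDeriv` on `𝒮_Ω^Σ`. -/
def preDerivCLM : Fin N ⊕ Fin N → Swo ω σ →L[ℂ] Swo ω σ :=
  Sum.elim (fun j => dPartialCLM ω σ (Sum.inl j)) (fun j => -coordMulCLM ω σ (Sum.inr j))

lemma coe_preDerivCLM (j : Fin N ⊕ Fin N) (f : Swo ω σ) :
    (preDerivCLM ω σ j f : R2 N → ℂ) = preDeriv f j := by
  rcases j with j | j
  · rfl
  · exact congrArg (-·) (coe_coordMulCLM ω σ (Sum.inr j) f)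

variable {ω σ}

lemma hasFDerivAt_partialFourier₂ (f : Swo ω σ) (z : R2 N) :
    HasFDerivAt (partialFourier₂ f)
      (∑ j, partialFourier₂ (preDerivCLM ω σ j f) z • coordI j) z := by
  have hdecay := controlledDecay_coe ω σ
  obtain ⟨q, -, g, hg, hb⟩ := hdecay.exists_slice_bound 0
  simp only [coe_preDerivCLM]
  refine UltraDiff.hasFDerivAt_partialFourier₂ (f.contDiff.differentiable (by simp))
    (hdecay.integrable_slice_snd f) (fun j x => ?_)
    (fun j => hg.const_mul (q (preDerivCLM ω σ j f))) (fun j x y => ?_) z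
  · rw [← coe_preDerivCLM]
    exact hdecay.integrable_slice_snd _ x
  · rw [← coe_preDerivCLM]
    simpa using hb (preDerivCLM ω σ j f) x y

lemma continuous_partialFourier₂ (f : Swo ω σ) : Continuous (partialFourier₂ f) :=
  continuous_iff_continuousAt.2 fun z => (f.hasFDerivAt_partialFourier₂ z).continuousAt

lemma integrable_partialFourier₂_slice_fst (f : Swo ω σ) (y : EuclideanSpace ℝ (Fin N)) :
    Integrable fun x => partialFourier₂ f (pair x y) := by
  obtain ⟨k, hk⟩ := exists_integrable_exp_neg (ω ∘ Sum.inl)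
  obtain ⟨q, -, hb⟩ := (controlledDecay_coe ω σ).dominated_partialFourier₂ k
  refine (hk.const_mul (q f)).mono' (f.continuous_partialFourier₂.comp
    (continuous_pair.comp (Continuous.prodMk_left y))).aestronglyMeasurable
    (ae_of_all _ fun x => le_mul_exp_neg (hb f (pair x y)))

lemma partialFourier₁_fourierT (f : Swo ω σ) (z : R2 N) :
    partialFourier₁ (fourierT f) z =
      (2 * Real.pi) ^ N * partialFourier₂ f (pair (-fstBlock z) (sndBlock z)) := by
  have hslice : (fun x => fourierT f (pair x (sndBlock z))) =
      fourierT fun x => partialFourier₂ f (pair x (sndBlock z)) := by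
    rw [fourierT_eq_partialFourier₁_partialFourier₂ f.integrable]
    rfl
  have hcont : Continuous fun x => partialFourier₂ f (pair x (sndBlock z)) :=
    f.continuous_partialFourier₂.comp (continuous_pair.comp (Continuous.prodMk_left _))
  have hint := (controlledDecay_fourierT ω σ).integrable_slice_fst f (sndBlock z)
  rw [hslice] at hint
  rw [partialFourier₁_apply, hslice, UltraDiff.fourierT_fourierT hcont
    (f.integrable_partialFourier₂_slice_fst _) hint, Fintype.card_fin]

variable (ω σ)

lemma dominated_partialFourier₂_snd (n : ℕ) : SeminormDominated fun (f : Swo ω σ) z =>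
    Real.exp (n * directSum (σ ∘ Sum.inr) (sndBlock z)) * ‖partialFourier₂ f z‖ := by
  have hpi : ‖((2 * Real.pi) ^ N : ℂ)‖ ≠ 0 := norm_ne_zero_iff.2 <|
    pow_ne_zero _ (mul_ne_zero two_ne_zero (ofReal_ne_zero.2 Real.pi_ne_zero))
  refine ((((controlledDecay_fourierT ω σ).dominated_partialFourier₁ n).comp_right
    fun z => pair (-fstBlock z) (sndBlock z)).const_mul ‖((2 * Real.pi) ^ N : ℂ)‖₊⁻¹).mono
    fun f z => le_of_eq ?_
  rw [partialFourier₁_fourierT, norm_mul, fstBlock_pair, sndBlock_pair, neg_neg,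
    pair_fstBlock_sndBlock, mul_left_comm (Real.exp _), NNReal.coe_inv, coe_nnnorm,
    inv_mul_cancel_left₀ hpi]

lemma controlledDecay_partialFourier₂ :
    ControlledDecay (mixWeights ω σ) fun f : Swo ω σ => partialFourier₂ f := by
  refine .of_hasFDerivAt hasFDerivAt_partialFourier₂ fun n => ?_
  refine (((controlledDecay_coe ω σ).dominated_partialFourier₂ (2 * n)).add
    (dominated_partialFourier₂_snd ω σ (2 * n))).mono fun f z => ?_
  have exp_add_le (a b : ℝ) : Real.exp (a + b) ≤ Real.exp (2 * a) + Real.exp (2 * b) := by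
    rcases le_total a b with hab | hab
    · exact (Real.exp_le_exp.2 (by linarith)).trans (le_add_of_nonneg_left (Real.exp_nonneg _))
    · exact (Real.exp_le_exp.2 (by linarith)).trans (le_add_of_nonneg_right (Real.exp_nonneg _))
  rw [← add_mul, directSum_eq_add, mul_add, Nat.cast_mul, Nat.cast_ofNat, mul_assoc, mul_assoc]
  gcongr
  exact exp_add_le _ _

variable {ω σ}

lemma fourierT_partialFourier₂ (f : Swo ω σ) :
    fourierT (partialFourier₂ f) = partialFourier₂ (fourierT f) := by
  rw [fourierT_eq_partialFourier₂_partialFourier₁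
    ((controlledDecay_partialFourier₂ ω σ).integrable f),
    fourierT_eq_partialFourier₁_partialFourier₂ f.integrable]

lemma partialFourier₂_add (f g : Swo ω σ) :
    partialFourier₂ (f + g : Swo ω σ) = partialFourier₂ f + partialFourier₂ g :=
  funext fun z => congrFun (fourierT_add ((controlledDecay_coe ω σ).integrable_slice_snd f _)
    ((controlledDecay_coe ω σ).integrable_slice_snd g _)) (sndBlock z)

end Swo

lemma partialFourier₂_smul {N : ℕ} (c : ℂ) (F : R2 N → ℂ) :
    partialFourier₂ (c • F) = c • partialFourier₂ F :=
  funext fun z => congrFun (fourierT_smul c fun y => F (pair (fstBlock z) y)) (sndBlock z)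

namespace Swo

section PartialFourierCLM

variable {N : ℕ} {ω σ ω' σ' : Fin N ⊕ Fin N → WeightFunction}

/-- The partial Fourier transform in the second block of variables. The weights of the codomain are
variables, so that the same map serves in both directions. -/
def partialFourier₂CLM (hω : mixWeights ω σ = ω') (hσ : mixWeights σ ω = σ') :
    Swo ω σ →L[ℂ] Swo ω' σ' :=
  liftCLM (fun f => partialFourier₂ f) partialFourier₂_add (fun c f => partialFourier₂_smul c f)
    (hω ▸ controlledDecay_partialFourier₂ ω σ) <| by
      simp only [fourierT_partialFourier₂, ← hσ]
      exact (controlledDecay_partialFourier₂ σ ω).comp (fourierCLM ω σ)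

/-- Exchange of the two blocks of variables. -/
def swapBlocksCLM (hω : ω' = ω ∘ Sum.swap) (hσ : σ' = σ ∘ Sum.swap) :
    Swo ω σ →L[ℂ] Swo ω' σ' :=
  compIsometryCLM ω σ (swapBlocks N) (fun z => hω ▸ (directSum_comp_swapBlocks ω z).le)
    fun z => hσ ▸ (directSum_comp_swapBlocks σ z).le

lemma mixWeights_comp_swap (ω σ : Fin N ⊕ Fin N → WeightFunction) :
    mixWeights (ω ∘ Sum.swap) (σ ∘ Sum.swap) = mixWeights σ ω ∘ Sum.swap := by
  ext1 (i | i) <;> rfl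

/-- The partial Fourier transform in the first block of variables, obtained from the one in the
second block by exchanging the blocks. -/
def partialFourier₁CLM (hω : mixWeights σ ω = ω') (hσ : mixWeights ω σ = σ') :
    Swo ω σ →L[ℂ] Swo ω' σ' :=
  swapBlocksCLM (by simp [Function.comp_assoc]) (by simp [Function.comp_assoc]) ∘L
    partialFourier₂CLM (ω' := ω' ∘ Sum.swap) (σ' := σ' ∘ Sum.swap)
      (hω ▸ mixWeights_comp_swap ω σ) (hσ ▸ mixWeights_comp_swap σ ω) ∘L
    swapBlocksCLM rfl rfl

lemma coe_partialFourier₁CLM (hω : mixWeights σ ω = ω') (hσ : mixWeights ω σ = σ') (f : Swo ω σ) :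
    (partialFourier₁CLM hω hσ f : R2 N → ℂ) = partialFourier₁ f := by
  change partialFourier₂ (f ∘ swapBlocks N) ∘ swapBlocks N = _
  rw [partialFourier₂_comp_swapBlocks]
  ext z
  simp

end PartialFourierCLM

section Pairing

variable {ι : Type} [Fintype ι] {ω σ ω' σ' : ι → WeightFunction}

lemma integrable_mul (f : Swo ω σ) (g : Swo ω' σ') : Integrable fun x => f x * g x :=
  f.integrable.mul_bdd g.contDiff.continuous.aestronglyMeasurable (ae_of_all _ (swo_norm_le g))

lemma precomp_regularDist {T : Swo ω σ →L[ℂ] Swo ω' σ'} {S : Swo ω' σ' →L[ℂ] Swo ω σ}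
    (hTS : ∀ (f : Swo ω σ) (φ : Swo ω' σ'), ∫ x, f x * S φ x = ∫ x, T f x * φ x) (f : Swo ω σ) :
    ContinuousLinearMap.precomp ℂ S (regularDist f) = regularDist (T f) :=
  ContinuousLinearMap.ext (hTS f)

variable {N : ℕ} {ω σ ω' σ' : Fin N ⊕ Fin N → WeightFunction}

lemma integral_mul_partialFourier₂ (f : Swo ω σ) (g : Swo ω' σ') :
    ∫ z, f z * partialFourier₂ g z = ∫ z, partialFourier₂ f z * g z := by
  have hf : Integrable fun z => f z * partialFourier₂ g z :=
    integrable_mul f (partialFourier₂CLM rfl rfl g)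
  have hg : Integrable fun z => partialFourier₂ f z * g z :=
    integrable_mul (partialFourier₂CLM rfl rfl f) g
  rw [integral_eq_integral_integral_pair hf, integral_eq_integral_integral_pair hg]
  exact congrArg (integral volume) <| funext fun x =>
    integral_mul_fourierT ((controlledDecay_coe ω σ).integrable_slice_snd f x)
      ((controlledDecay_coe ω' σ').integrable_slice_snd g x)

lemma integral_mul_partialFourier₁ (f : Swo ω σ) (g : Swo ω' σ') :
    ∫ z, f z * partialFourier₁ g z = ∫ z, partialFourier₁ f z * g z := by
  have integral_swap (F : R2 N → ℂ) : ∫ z, F (swapBlocks N z) = ∫ z, F z :=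
    (swapBlocks N).measurePreserving.integral_comp
      (swapBlocks N).toHomeomorph.measurableEmbedding F
  have h := integral_mul_partialFourier₂ (swapBlocksCLM rfl rfl f) (swapBlocksCLM rfl rfl g)
  change ∫ z, f (swapBlocks N z) * partialFourier₂ (g ∘ swapBlocks N) z =
    ∫ z, partialFourier₂ (f ∘ swapBlocks N) z * g (swapBlocks N z) at h
  rw [partialFourier₂_comp_swapBlocks, partialFourier₂_comp_swapBlocks] at h
  rwa [← integral_swap, ← integral_swap fun z => partialFourier₁ f z * g z]

end Pairing

end Swo

lemma continuous_weakDual_precomp {E F : Type*} [AddCommGroup E] [Module ℂ E] [TopologicalSpace E]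
    [AddCommGroup F] [Module ℂ F] [TopologicalSpace F] (S : F →L[ℂ] E) :
    Continuous fun u : WeakDual ℂ E =>
      StrongDual.toWeakDual (ContinuousLinearMap.precomp ℂ S (WeakDual.toStrongDual u)) :=
  WeakDual.continuous_of_continuous_eval fun x => WeakDual.eval_continuous (S x)

end

end UltraDiff

theorem mainTheorem7 (N : ℕ) (ω σ : Fin N ⊕ Fin N → WeightFunction) :
    (∃ T : Swo ω σ →L[ℂ] Swo (mixWeights ω σ) (mixWeights σ ω),
      (∀ F : Swo ω σ, ∀ z : R2 N, T F z = partialFourier₂ F z) ∧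
      ∃ T' : StrongDual ℂ (Swo ω σ) →L[ℂ] StrongDual ℂ (Swo (mixWeights ω σ) (mixWeights σ ω)),
        (∀ φ : Swo (mixWeights ω σ) (mixWeights σ ω), ∃ ψ : Swo ω σ,
          (∀ z : R2 N, ψ z = partialFourier₂ φ z) ∧
          ∀ u : StrongDual ℂ (Swo ω σ), T' u φ = u ψ) ∧
        (∀ F : Swo ω σ, T' (regularDist F) = regularDist (T F)) ∧
        Continuous (fun u : WeakDual ℂ (Swo ω σ) =>
          StrongDual.toWeakDual (T' (WeakDual.toStrongDual u)))) ∧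
    (∃ T : Swo ω σ →L[ℂ] Swo (mixWeights σ ω) (mixWeights ω σ),
      (∀ F : Swo ω σ, ∀ z : R2 N, T F z = partialFourier₁ F z) ∧
      ∃ T' : StrongDual ℂ (Swo ω σ) →L[ℂ] StrongDual ℂ (Swo (mixWeights σ ω) (mixWeights ω σ)),
        (∀ φ : Swo (mixWeights σ ω) (mixWeights ω σ), ∃ ψ : Swo ω σ,
          (∀ z : R2 N, ψ z = partialFourier₁ φ z) ∧
          ∀ u : StrongDual ℂ (Swo ω σ), T' u φ = u ψ) ∧
        (∀ F : Swo ω σ, T' (regularDist F) = regularDist (T F)) ∧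
        Continuous (fun u : WeakDual ℂ (Swo ω σ) =>
          StrongDual.toWeakDual (T' (WeakDual.toStrongDual u)))) := by
  constructor
  · let T := Swo.partialFourier₂CLM (ω := ω) (σ := σ) rfl rfl
    let S := Swo.partialFourier₂CLM (mixWeights_mixWeights ω σ) (mixWeights_mixWeights σ ω)
    exact ⟨T, fun F z => rfl, ContinuousLinearMap.precomp ℂ S,
      fun φ => ⟨S φ, fun z => rfl, fun u => rfl⟩,
      Swo.precomp_regularDist Swo.integral_mul_partialFourier₂, continuous_weakDual_precomp S⟩
  · let T := Swo.partialFourier₁CLM (ω := ω) (σ := σ) rfl rfl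
    let S := Swo.partialFourier₁CLM (mixWeights_mixWeights ω σ) (mixWeights_mixWeights σ ω)
    have hT (F : Swo ω σ) : (T F : R2 N → ℂ) = partialFourier₁ F := Swo.coe_partialFourier₁CLM _ _ F
    have hS (φ) : (S φ : R2 N → ℂ) = partialFourier₁ φ := Swo.coe_partialFourier₁CLM _ _ φ
    exact ⟨T, fun F => congrFun (hT F), ContinuousLinearMap.precomp ℂ S,
      fun φ => ⟨S φ, congrFun (hS φ), fun u => rfl⟩,
      Swo.precomp_regularDist fun F φ => by
        rw [hS, hT]
        exact Swo.integral_mul_partialFourier₁ F φ,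
      continuous_weakDual_precomp S⟩
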